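/- **Theorem 1.1.** Let $r>0$, let $B=B(O,r)\subset\mathbb{R}^2$ be the open disc with coordinates $(x,y)$, and let $g=(g_{ij})$ be a Riemannian metric on $B$ whose components are $C^4$ functions of $(x,y)$ and whose Gauss curvature is positive on $B\setminus\{O\}$. Suppose that $X:(B,g)\to\mathbb{R}^3$, $X(x,y)=(x,y,u(x,y))$, is an isometric embedding of class $C^{1,1}$, where $u(0)=0$ and $\nabla u(0)=0$. Then $X\in C^{2,1}(B)$. Here $C^{k,1}(B)$ means: of class $C^k$ on $B$, with $k$-th derivatives that are Lipschitz near each point of $B$ (equivalently, on each smaller disc $B(O,r')$, $r'<r$). If, moreover, all derivatives of order at most $4$ of the components $g_{ij}$ are bounded on $B$, then the second derivatives of $X$ are Lipschitz on the whole of $B$. This regularity is optimal: for every $r>0$, the function $u=(x^2+y^2)^{3/2}$ satisfies all of the hypotheses on $B(O,r)$ (with a metric $g$ that is even $C^\infty$), but the corresponding $X$ is not of class $C^3$ on $B(O,r)$. -/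

import Mathlib

open Set Topology
open scoped ContDiff

namespace GraphEmbedding

/-- The Euclidean plane with its standard coordinates `x = p 0`, `y = p 1`. -/
abbrev Plane : Type := EuclideanSpace ℝ (Fin 2)

/-- Euclidean 3-space with its flat inner product. -/
abbrev Space : Type := EuclideanSpace ℝ (Fin 3)

noncomputable section

/-- The `i`-th partial derivative of a (vector valued) function on the plane. -/
def pderiv {F : Type*} [NormedAddCommGroup F] [NormedSpace ℝ F]
    (i : Fin 2) (f : Plane → F) (p : Plane) : F :=
  fderiv ℝ f p (EuclideanSpace.single i 1)

/-- `g = (g_ij)` is a Riemannian metric of class `C^n` on the open set `U`, in the coordinates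
of the plane. -/
def IsMetricOn (n : WithTop ℕ∞) (g : Plane → Matrix (Fin 2) (Fin 2) ℝ) (U : Set Plane) : Prop :=
  (∀ i j, ContDiffOn ℝ n (fun p => g p i j) U) ∧ ∀ p ∈ U, (g p).PosDef

/-- The Christoffel symbols `Γ^n_ij = ½ g^{nl} (∂_i g_jl + ∂_j g_il - ∂_l g_ij)`. -/
def christoffel (g : Plane → Matrix (Fin 2) (Fin 2) ℝ) (n i j : Fin 2) (p : Plane) : ℝ :=
  (1 / 2) * ∑ l, (g p)⁻¹ n l *
    (pderiv i (fun q => g q j l) p + pderiv j (fun q => g q i l) p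
      - pderiv l (fun q => g q i j) p)

/-- The covariant Riemann curvature tensor in coordinates,
`R_iklm = ½ (∂_k∂_l g_im + ∂_i∂_m g_kl - ∂_k∂_m g_il - ∂_i∂_l g_km)
  + g_ab (Γ^a_kl Γ^b_im - Γ^a_km Γ^b_il)`. -/
def riemann (g : Plane → Matrix (Fin 2) (Fin 2) ℝ) (i k l m : Fin 2) (p : Plane) : ℝ :=
  (1 / 2) * (pderiv k (pderiv l fun q => g q i m) p + pderiv i (pderiv m fun q => g q k l) p
      - pderiv k (pderiv m fun q => g q i l) p - pderiv i (pderiv l fun q => g q k m) p)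
    + ∑ a, ∑ b, g p a b * (christoffel g a k l p * christoffel g b i m p
      - christoffel g a k m p * christoffel g b i l p)

/-- The Gauss curvature `R_1212 / det g` of the metric `g` (positive for round spheres). -/
def gaussCurvature (g : Plane → Matrix (Fin 2) (Fin 2) ℝ) (p : Plane) : ℝ :=
  riemann g 0 1 0 1 p / (g p).det

/-- `f` is of class `C^{k,1}` on the open set `U`: it is `C^k` there and its `k`-th derivative is
Lipschitz in a neighbourhood of each point of `U`
(equivalently, Lipschitz on each compact subset of `U`). -/
def IsCkLipOn {F : Type*} [NormedAddCommGroup F] [NormedSpace ℝ F]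
    (k : ℕ) (f : Plane → F) (U : Set Plane) : Prop :=
  ContDiffOn ℝ k f U ∧ LocallyLipschitzOn U (iteratedFDeriv ℝ k f)

/-- All derivatives of order at most `n` of the components of `g` are bounded on `U`. -/
def HasBoundedDerivsOn (n : ℕ) (g : Plane → Matrix (Fin 2) (Fin 2) ℝ) (U : Set Plane) : Prop :=
  ∃ C : ℝ, ∀ i j, ∀ m ≤ n, ∀ p ∈ U, ‖iteratedFDeriv ℝ m (fun q => g q i j) p‖ ≤ C

/-- The first fundamental form `⟨∂_i X, ∂_j X⟩` of a map `X` from the plane to 3-space. -/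
def firstFundamentalForm (X : Plane → Space) (p : Plane) : Matrix (Fin 2) (Fin 2) ℝ :=
  Matrix.of fun i j => inner ℝ (pderiv i X p) (pderiv j X p)

/-- `X : (U, g) → ℝ³` is an isometric embedding (of class at least `C^1`). -/
def IsIsometricEmbeddingOn (g : Plane → Matrix (Fin 2) (Fin 2) ℝ) (X : Plane → Space)
    (U : Set Plane) : Prop :=
  ContDiffOn ℝ 1 X U ∧ (∀ p ∈ U, firstFundamentalForm X p = g p) ∧ IsEmbedding (U.domRestrict X)

/-- The graph map `(x, y) ↦ (x, y, u (x, y))`. -/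
def graphMap (u : Plane → ℝ) (p : Plane) : Space :=
  !₂[p 0, p 1, u p]

/-- The function `u = (x² + y²)^{3/2}`. -/
def cubicCone (p : Plane) : ℝ :=
  ((p 0) ^ 2 + (p 1) ^ 2) ^ (3 / 2 : ℝ)

end

end GraphEmbedding

open GraphEmbedding

namespace GraphEmbedding

set_option maxSynthPendingDepth 3

/-! The metric of the graph is `g_ij = δ_ij + u_i u_j`, so the square of each directional
derivative, `(∂_v u)² = vᵀ g v - |v|²`, is of class `C⁴`. Where `∇u ≠ 0` square roots can be taken:
`u` is `C⁵` there, and positive curvature makes its Hessian determinant positive. What is needed is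
a bound on `D³u` that survives the degeneration at the critical points.

Convexity. At a critical point off the origin the second derivatives of `g` replace those of `u`,
and positive curvature makes the point isolated (`eventually_fderiv_ne`). The critical set is
therefore countable, its complement in the disc is connected, `u_xx` has one sign there, and `u` or
`-u` is convex. Critical points of a convex function are minimisers and form a convex set, so
isolation leaves only the origin (`fderiv_ne_zero`).

Third derivatives. On a line let `f = ∂_v u`, monotone by convexity, and `F = f²`, with derivatives
of orders one to four bounded. Then `4 f³ f'' = 2 F F'' - F'²`, and the right side is `O(|f|³)`
(`exists_bound`). Indeed, let `f > 0` be small at a point. If `f` stays nonnegative back to distance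
`√f`, monotonicity makes `F` small on that interval and interpolation bounds `F'` and `F''`.
Otherwise `f` has a zero that close; there `F ≥ 0` forces `F''' = O(√F'')`, and the leading terms of
the Taylor expansion cancel in `2 F F'' - F'²`. Four directions with `∂_v u = |∇u|` then control all
of `D³u` (`norm_trilinear_le`), and the Lipschitz bound for `D²u` extends across the origin.

Near the boundary lines have no room, but convexity bounds `|∇u|` below there, so the identity can
be divided by `f³` directly. For `u = |p|³` the metric is polynomial while `u_xx = 6|x|` on the
first axis. -/

/-! ### One-variable estimates for squares of monotone functions -/

theorem abs_sub_le_mul_pow {φ φ' : ℝ → ℝ} {s t M : ℝ} {k : ℕ} (hM : 0 ≤ M)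
    (h : ∀ x ∈ uIcc s t, HasDerivAt φ (φ' x) x)
    (hb : ∀ x ∈ uIcc s t, |φ' x| ≤ M * |x - s| ^ k) :
    |φ t - φ s| ≤ M * |t - s| ^ (k + 1) := by
  have := Convex.norm_image_sub_le_of_norm_hasDerivWithin_le (f := φ) (f' := φ')
    (C := M * |t - s| ^ k) (s := uIcc s t) (x := s) (y := t)
    (fun x hx => (h x hx).hasDerivWithinAt) (fun x hx => ?_) (convex_uIcc s t)
    left_mem_uIcc right_mem_uIcc
  · rw [Real.norm_eq_abs, Real.norm_eq_abs] at this
    rwa [pow_succ, ← mul_assoc]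
  · refine (hb x hx).trans ?_
    have : |x - s| ≤ |t - s| := abs_sub_left_of_mem_uIcc hx
    gcongr

/-- A chain of successive derivatives `F 0, …, F 4` on `[-d, d]`, the last four bounded by `M`. -/
structure IsBoundedChain (F : ℕ → ℝ → ℝ) (d M : ℝ) : Prop where
  hasDerivAt : ∀ j < 4, ∀ t ∈ Icc (-d) d, HasDerivAt (F j) (F (j + 1) t) t
  bound : ∀ j ∈ Icc 1 4, ∀ t ∈ Icc (-d) d, |F j t| ≤ M

namespace IsBoundedChain

variable {F : ℕ → ℝ → ℝ} {d M : ℝ}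

/-- The bound on the fourth derivative is integrated four times; the factorials gained in the
denominators are discarded. -/
theorem taylor (h : IsBoundedChain F d M) (hM : 0 ≤ M) {s t : ℝ} (hs : s ∈ Icc (-d) d)
    (ht : t ∈ Icc (-d) d) :
    |F 2 t - (F 2 s + F 3 s * (t - s))| ≤ M * |t - s| ^ 2 ∧
    |F 1 t - (F 1 s + F 2 s * (t - s) + F 3 s * (t - s) ^ 2 / 2)| ≤ M * |t - s| ^ 3 ∧
    |F 0 t - (F 0 s + F 1 s * (t - s) + F 2 s * (t - s) ^ 2 / 2 + F 3 s * (t - s) ^ 3 / 6)|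
      ≤ M * |t - s| ^ 4 := by
  have key : ∀ t ∈ Icc (-d) d, uIcc s t ⊆ Icc (-d) d := fun t ht => (uIcc_subset_Icc hs ht)
  have h3 : ∀ t ∈ Icc (-d) d, |F 3 t - F 3 s| ≤ M * |t - s| ^ 1 := by
    intro t ht
    refine abs_sub_le_mul_pow hM (fun x hx => h.hasDerivAt 3 (by norm_num) x (key t ht hx))
      fun x hx => ?_
    simpa using h.bound 4 (by simp) x (key t ht hx)
  have h2 : ∀ t ∈ Icc (-d) d, |F 2 t - (F 2 s + F 3 s * (t - s))| ≤ M * |t - s| ^ 2 := by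
    intro t ht
    have := abs_sub_le_mul_pow (φ := fun x => F 2 x - F 3 s * (x - s))
      (φ' := fun x => F 3 x - F 3 s) (s := s) (t := t) (k := 1) hM (fun x hx => ?_)
      fun x hx => h3 x (key t ht hx)
    · convert this using 2
      simp; ring
    · refine ((h.hasDerivAt 2 (by norm_num) x (key t ht hx)).fun_sub
        (((hasDerivAt_id' x).sub_const s).const_mul (F 3 s))).congr_deriv ?_
      simp
  have h1 : ∀ t ∈ Icc (-d) d,
      |F 1 t - (F 1 s + F 2 s * (t - s) + F 3 s * (t - s) ^ 2 / 2)| ≤ M * |t - s| ^ 3 := by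
    intro t ht
    have := abs_sub_le_mul_pow (φ := fun x => F 1 x - (F 2 s * (x - s) + F 3 s * (x - s) ^ 2 / 2))
      (φ' := fun x => F 2 x - (F 2 s + F 3 s * (x - s))) (s := s) (t := t) (k := 2) hM
      (fun x hx => ?_) fun x hx => h2 x (key t ht hx)
    · convert this using 2
      simp; ring
    · refine ((h.hasDerivAt 1 (by norm_num) x (key t ht hx)).fun_sub
        ((((hasDerivAt_id' x).sub_const s).const_mul (F 2 s)).fun_add
          (((((hasDerivAt_id' x).sub_const s).fun_pow 2).const_mul (F 3 s)).div_const 2))).congr_deriv ?_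
      simp; ring
  refine ⟨h2 t ht, h1 t ht, ?_⟩
  have := abs_sub_le_mul_pow (φ := fun x => F 0 x - (F 1 s * (x - s) + F 2 s * (x - s) ^ 2 / 2
      + F 3 s * (x - s) ^ 3 / 6))
    (φ' := fun x => F 1 x - (F 1 s + F 2 s * (x - s) + F 3 s * (x - s) ^ 2 / 2))
    (s := s) (t := t) (k := 3) hM (fun x hx => ?_) fun x hx => h1 x (key t ht hx)
  · convert this using 2
    simp; ring
  · refine ((h.hasDerivAt 0 (by norm_num) x (key t ht hx)).fun_sub
      (((((hasDerivAt_id' x).sub_const s).const_mul (F 1 s)).fun_add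
        (((((hasDerivAt_id' x).sub_const s).fun_pow 2).const_mul (F 2 s)).div_const 2)).fun_add
        (((((hasDerivAt_id' x).sub_const s).fun_pow 3).const_mul (F 3 s)).div_const 6))).congr_deriv ?_
    simp; ring

/-- At an interior zero of a nonnegative function with bounded fourth derivative, the second
derivative controls the third. -/
theorem third_le_of_zero (h : IsBoundedChain F d M) (hM : 0 ≤ M) (hd : 0 < d) {z : ℝ}
    (hz : |z| ≤ d / 2) (h0 : ∀ t ∈ Icc (-d) d, 0 ≤ F 0 t) (hFz : F 0 z = 0) :
    F 1 z = 0 ∧ ∃ k, 0 ≤ k ∧ F 2 z = 2 * k ^ 2 ∧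
      ∃ γ, |γ| ≤ 2 * (M + 1) / d + M * (d / (2 * (M + 1))) ∧ F 3 z = 6 * (k * γ) := by
  have hz' := abs_le.1 hz
  have hzI : z ∈ Icc (-d) d := ⟨by linarith, by linarith⟩
  have h1 : F 1 z = 0 := by
    refine IsLocalMin.hasDerivAt_eq_zero (f := F 0) (a := z) ?_ (h.hasDerivAt 0 (by norm_num) z hzI)
    filter_upwards [Icc_mem_nhds (show -d < z by linarith) (show z < d by linarith)] with t ht
    rw [hFz]; exact h0 t ht
  -- The Taylor estimate combined with `F ≥ 0`, divided by `τ²`. Using both signs of `τ` gives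
  -- `hcb`.
  have hexp : ∀ τ, |τ| ≤ d / 2 → τ ≠ 0 → 0 ≤ F 2 z / 2 + F 3 z / 6 * τ + M * τ ^ 2 := by
    intro τ hτ hτ0
    have hτ' := abs_le.1 hτ
    have hI : z + τ ∈ Icc (-d) d := ⟨by linarith, by linarith⟩
    have h4 := (abs_le.1 (h.taylor hM hzI hI).2.2).2
    have := h0 _ hI
    rw [hFz, h1, show z + τ - z = τ by ring,
      show |τ| ^ 4 = τ ^ 4 by rw [← abs_pow, abs_of_nonneg (by positivity)]] at h4
    have hp : 0 ≤ τ ^ 2 * (F 2 z / 2 + F 3 z / 6 * τ + M * τ ^ 2) := by nlinarith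
    exact nonneg_of_mul_nonneg_right hp (by positivity)
  have hK : 0 ≤ F 2 z / 2 := by
    have ht : Filter.Tendsto (fun τ : ℝ => F 2 z / 2 + M * τ ^ 2) (𝓝[>] 0)
        (𝓝 (F 2 z / 2 + M * 0 ^ 2)) :=
      (Continuous.tendsto (by fun_prop) 0).mono_left nhdsWithin_le_nhds
    rw [show F 2 z / 2 = F 2 z / 2 + M * 0 ^ 2 by ring]
    refine ge_of_tendsto ht ?_
    filter_upwards [Ioo_mem_nhdsGT (show (0 : ℝ) < d / 2 by linarith)] with τ hτ
    have e1 := hexp τ (by rw [abs_of_pos hτ.1]; exact hτ.2.le) hτ.1.ne'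
    have e2 := hexp (-τ) (by rw [abs_neg, abs_of_pos hτ.1]; exact hτ.2.le) (by linarith [hτ.1])
    nlinarith
  have hcb : ∀ τ, 0 < τ → τ ≤ d / 2 → |F 3 z / 6| * τ ≤ F 2 z / 2 + M * τ ^ 2 := by
    intro τ h0τ hτ
    have e1 := hexp τ (by rw [abs_of_pos h0τ]; exact hτ) h0τ.ne'
    have e2 := hexp (-τ) (by rw [abs_neg, abs_of_pos h0τ]; exact hτ) (by linarith)
    rw [← abs_of_pos h0τ, ← abs_mul, abs_of_pos h0τ, abs_le]
    constructor <;> nlinarith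
  set k := √(F 2 z / 2) with hk
  have hk2 : k ^ 2 = F 2 z / 2 := Real.sq_sqrt hK
  have hk0 : 0 ≤ k := Real.sqrt_nonneg _
  refine ⟨h1, k, hk0, by linarith, ?_⟩
  have hM1 : 0 < M + 1 := by linarith
  have hF2 : F 2 z ≤ M := (le_abs_self _).trans (h.bound 2 (by simp) z hzI)
  have hkM : k ≤ M + 1 := by nlinarith
  rcases hk0.eq_or_lt with hk00 | hkpos
  -- For `k = 0`, letting `τ → 0` in `hcb` forces the third derivative to vanish.
  · refine ⟨0, by simp; positivity, ?_⟩
    have : |F 3 z / 6| ≤ 0 := by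
      have ht : Filter.Tendsto (fun τ : ℝ => M * τ) (𝓝[>] 0) (𝓝 (M * 0)) :=
        (Continuous.tendsto (by fun_prop) 0).mono_left nhdsWithin_le_nhds
      rw [mul_zero] at ht
      refine ge_of_tendsto ht ?_
      filter_upwards [Ioo_mem_nhdsGT (show (0 : ℝ) < d / 2 by linarith)] with τ hτ
      have := hcb τ hτ.1 hτ.2.le
      rw [← hk2, ← hk00] at this
      have hτ0 := hτ.1
      refine le_of_mul_le_mul_right ?_ hτ0
      nlinarith
    have := abs_eq_zero.1 (le_antisymm this (abs_nonneg _))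
    linarith
  · refine ⟨F 3 z / 6 / k, ?_, by field_simp⟩
    -- At `τ = k η` both terms `k²` and `M τ²` are multiples of `k²`; this `η` keeps `k η ≤ d / 2`,
    -- because `k ≤ M + 1`.
    set η := d / (2 * (M + 1)) with hη
    have hη0 : 0 < η := by positivity
    have hηk : k * η ≤ d / 2 := by
      calc k * η ≤ (M + 1) * η := by gcongr
        _ = d / 2 := by rw [hη]; field_simp
    have := hcb (k * η) (by positivity) hηk
    rw [← hk2] at this
    rw [abs_div, abs_of_pos hkpos, div_le_iff₀ hkpos, show 2 * (M + 1) / d = 1 / η by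
      rw [hη]; field_simp]
    have h5 : |F 3 z / 6| * (k * η) ≤ ((1 / η + M * η) * k) * (k * η) := by
      refine this.trans (le_of_eq ?_)
      field_simp
    exact le_of_mul_le_mul_right h5 (by positivity)

end IsBoundedChain

namespace IsBoundedChain

variable {F : ℕ → ℝ → ℝ} {d M : ℝ}

/-- Interpolation: one-sided smallness of `F 0` at scale `s` controls the lower derivatives. -/
theorem interpolate (h : IsBoundedChain F d M) (hM : 0 ≤ M) {s : ℝ} (hs : 0 < s) (hsd : s ≤ d)
    (hF : ∀ t ∈ Icc (-s) 0, F 0 t ∈ Icc 0 (s ^ 4)) :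
    |F 1 0| ≤ 15 * (1 + M) * s ^ 3 ∧ |F 2 0| ≤ 90 * (1 + M) * s ^ 2 := by
  have key : ∀ θ ∈ Icc (0 : ℝ) 1, |-(F 1 0 * s) * θ + F 2 0 * s ^ 2 / 2 * θ ^ 2
      - F 3 0 * s ^ 3 / 6 * θ ^ 3| ≤ (1 + M) * s ^ 4 := by
    intro θ hθ
    have hθs : θ * s ≤ s := by nlinarith [hθ.2]
    have hθs0 : 0 ≤ θ * s := by nlinarith [hθ.1]
    have ht := (h.taylor hM (s := 0) (t := -(θ * s)) ⟨by linarith, by linarith⟩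
      ⟨by linarith, by linarith⟩).2.2
    have h4 : |(-(θ * s)) - 0| ^ 4 ≤ s ^ 4 := by
      rw [sub_zero, abs_neg, abs_of_nonneg hθs0]; gcongr
    have h5 := abs_le.1 (ht.trans (mul_le_mul_of_nonneg_left h4 hM))
    have f0 := hF 0 ⟨by linarith, le_rfl⟩
    have f1 := hF (-(θ * s)) ⟨by linarith, by linarith⟩
    rw [abs_le]
    constructor <;> nlinarith [f0.1, f0.2, f1.1, f1.2, h5.1, h5.2]
  -- Three values determine a cubic without constant term. Inverting the system bounds the linear
  -- coefficient by 14.5 times the bound, and the quadratic one, which is half of `F 2 0 * s ^ 2`,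
  -- by 45 times.
  have k1 := abs_le.1 (key (1 / 3) (by norm_num))
  have k2 := abs_le.1 (key (2 / 3) (by norm_num))
  have k3 := abs_le.1 (key 1 (by norm_num))
  have hN : 0 ≤ (1 + M) * s ^ 4 := by positivity
  have a1 : |F 1 0 * s| ≤ 15 * (1 + M) * s ^ 4 := by
    rw [abs_le]; constructor <;> linarith [k1.1, k1.2, k2.1, k2.2, k3.1, k3.2]
  have a2 : |F 2 0 * s ^ 2| ≤ 90 * (1 + M) * s ^ 4 := by
    rw [abs_le]; constructor <;> linarith [k1.1, k1.2, k2.1, k2.2, k3.1, k3.2]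
  rw [abs_mul, abs_of_pos hs] at a1
  rw [abs_mul, abs_of_pos (by positivity : 0 < s ^ 2)] at a2
  exact ⟨le_of_mul_le_mul_right (a1.trans (le_of_eq (by ring))) hs,
    le_of_mul_le_mul_right (a2.trans (le_of_eq (by ring))) (by positivity : 0 < s ^ 2)⟩

/-- The left side is `2 F F'' - F'²` at distance `σ` from a zero of `F`, after its leading terms
have cancelled. What remains is homogeneous of degree three in `X = kσ` and `Y = σ²`. Here `Y ≤ a`
by hypothesis, and `X` is at most a constant times `a` because `F = a²`, the cross term being
absorbed by Young's inequality. -/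
theorem near_zero_bound {M C a k σ γ ρ₀ ρ₁ ρ₂ : ℝ} (hM : 0 ≤ M) (ha : 0 < a)
    (hk : 0 ≤ k) (hσ : 0 ≤ σ) (hσa : σ ^ 2 ≤ a) (hγ : |γ| ≤ C) (h0 : |ρ₀| ≤ M) (h1 : |ρ₁| ≤ M)
    (h2 : |ρ₂| ≤ M) (hF : a ^ 2 = (k * σ) ^ 2 + γ * (k * σ) * σ ^ 2 + ρ₀ * (σ ^ 2) ^ 2) :
    |4 * γ * (k * σ) ^ 3 + (3 * γ ^ 2 + 2 * ρ₂ + 4 * ρ₀ - 4 * ρ₁) * ((k * σ) ^ 2 * σ ^ 2)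
      + (2 * γ * ρ₂ + 12 * ρ₀ * γ - 6 * γ * ρ₁) * ((k * σ) * (σ ^ 2) ^ 2)
      + (2 * ρ₀ * ρ₂ - ρ₁ ^ 2) * (σ ^ 2) ^ 3|
      ≤ (4 * C * (2 + C ^ 2 + 2 * M) ^ 3 + (3 * C ^ 2 + 10 * M) * (2 + C ^ 2 + 2 * M) ^ 2
        + 20 * C * M * (2 + C ^ 2 + 2 * M) + 3 * M ^ 2) * a ^ 3 := by
  have hC : 0 ≤ C := (abs_nonneg _).trans hγ
  set X := k * σ with hX
  set Y := σ ^ 2 with hY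
  have hX0 : 0 ≤ X := by positivity
  have hY0 : 0 ≤ Y := by positivity
  set D := 2 + C ^ 2 + 2 * M with hD
  have hD1 : 1 ≤ D := by nlinarith [sq_nonneg C]
  have hYa : Y ^ 2 ≤ a ^ 2 := by gcongr
  have hXD : X ≤ D * a := by
    have g1 := (abs_le.1 hγ).1
    have g2 := (abs_le.1 h0).1
    have e1 : -(C * (X * Y)) ≤ γ * X * Y := by nlinarith [mul_nonneg hX0 hY0]
    have e2 : -(M * Y ^ 2) ≤ ρ₀ * Y ^ 2 := by nlinarith [sq_nonneg Y]
    have e3 : X ^ 2 ≤ D * a ^ 2 := by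
      have : X ^ 2 / 2 ≤ a ^ 2 + (C ^ 2 / 2 + M) * Y ^ 2 := by nlinarith [sq_nonneg (X - C * Y)]
      have : (C ^ 2 / 2 + M) * Y ^ 2 ≤ (C ^ 2 / 2 + M) * a ^ 2 := by gcongr
      rw [hD]; linarith
    refine le_of_sq_le_sq ?_ (by positivity)
    nlinarith [sq_nonneg a, mul_nonneg (by linarith : 0 ≤ D - 1) (by positivity : 0 ≤ D * a ^ 2)]
  have t1 : |4 * γ * X ^ 3| ≤ 4 * C * D ^ 3 * a ^ 3 := by
    rw [abs_mul, abs_mul, abs_of_nonneg (by positivity : 0 ≤ X ^ 3), abs_of_pos (by norm_num)]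
    calc 4 * |γ| * X ^ 3 ≤ 4 * C * (D * a) ^ 3 := by gcongr
      _ = _ := by ring
  have c2 : |3 * γ ^ 2 + 2 * ρ₂ + 4 * ρ₀ - 4 * ρ₁| ≤ 3 * C ^ 2 + 10 * M := by
    have : γ ^ 2 ≤ C ^ 2 := sq_le_sq' (abs_le.1 hγ).1 (abs_le.1 hγ).2
    have := abs_le.1 h0; have := abs_le.1 h1; have := abs_le.1 h2
    rw [abs_le]; constructor <;> nlinarith [sq_nonneg γ, sq_nonneg C]
  have hγρ : ∀ ρ, |ρ| ≤ M → |γ * ρ| ≤ C * M := fun ρ hρ => by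
    rw [abs_mul]; gcongr
  have c3 : |2 * γ * ρ₂ + 12 * ρ₀ * γ - 6 * γ * ρ₁| ≤ 20 * C * M := by
    have := abs_le.1 (hγρ _ h0); have := abs_le.1 (hγρ _ h1); have := abs_le.1 (hγρ _ h2)
    rw [abs_le]; constructor <;> linarith
  have c4 : |2 * ρ₀ * ρ₂ - ρ₁ ^ 2| ≤ 3 * M ^ 2 := by
    have : |ρ₀ * ρ₂| ≤ M * M := by rw [abs_mul]; gcongr
    have := abs_le.1 this
    have : ρ₁ ^ 2 ≤ M ^ 2 := sq_le_sq' (abs_le.1 h1).1 (abs_le.1 h1).2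
    rw [abs_le]; constructor <;> nlinarith [sq_nonneg ρ₁]
  have t2 : |(3 * γ ^ 2 + 2 * ρ₂ + 4 * ρ₀ - 4 * ρ₁) * (X ^ 2 * Y)|
      ≤ (3 * C ^ 2 + 10 * M) * D ^ 2 * a ^ 3 := by
    rw [abs_mul, abs_of_nonneg (by positivity : 0 ≤ X ^ 2 * Y)]
    calc _ ≤ (3 * C ^ 2 + 10 * M) * ((D * a) ^ 2 * a) := by gcongr
      _ = _ := by ring
  have t3 : |(2 * γ * ρ₂ + 12 * ρ₀ * γ - 6 * γ * ρ₁) * (X * Y ^ 2)|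
      ≤ 20 * C * M * D * a ^ 3 := by
    rw [abs_mul, abs_of_nonneg (by positivity : 0 ≤ X * Y ^ 2)]
    calc _ ≤ (20 * C * M) * ((D * a) * a ^ 2) := by gcongr
      _ = _ := by ring
  have t4 : |(2 * ρ₀ * ρ₂ - ρ₁ ^ 2) * Y ^ 3| ≤ 3 * M ^ 2 * a ^ 3 := by
    rw [abs_mul, abs_of_nonneg (by positivity : 0 ≤ Y ^ 3)]
    gcongr
  rw [show (4 * C * D ^ 3 + (3 * C ^ 2 + 10 * M) * D ^ 2 + 20 * C * M * D + 3 * M ^ 2) * a ^ 3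
    = 4 * C * D ^ 3 * a ^ 3 + (3 * C ^ 2 + 10 * M) * D ^ 2 * a ^ 3 + 20 * C * M * D * a ^ 3
      + 3 * M ^ 2 * a ^ 3 by ring]
  exact (abs_add_le _ _).trans (add_le_add ((abs_add_le _ _).trans
    (add_le_add ((abs_add_le _ _).trans (add_le_add t1 t2)) t3)) t4)

/-- The quantity `2 F F'' - F'²` is `4 g³ g''` when `F = g²`; for monotone `g` it is `O(g³)`. -/
theorem exists_bound_of_pos (M d : ℝ) (hM : 0 ≤ M) (hd : 0 < d) : ∃ C, ∀ (F : ℕ → ℝ → ℝ) (g : ℝ → ℝ),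
    IsBoundedChain F d M → (∀ t ∈ Icc (-d) d, F 0 t = g t ^ 2) → ContinuousOn g (Icc (-d) d) →
    MonotoneOn g (Icc (-d) d) → 0 < g 0 → |2 * F 0 0 * F 2 0 - F 1 0 ^ 2| ≤ C * g 0 ^ 3 := by
  set C₁ := 2 * (M + 1) / d + M * (d / (2 * (M + 1))) with hC₁
  set α := d ^ 2 / 4 with hα
  have hα0 : 0 < α := by positivity
  set B₁ := 2 * M / α + M ^ 2 / α ^ 3
  set B₂ := 180 * (1 + M) + (15 * (1 + M)) ^ 2
  set B₃ := (4 * C₁ * (2 + C₁ ^ 2 + 2 * M) ^ 3 + (3 * C₁ ^ 2 + 10 * M) * (2 + C₁ ^ 2 + 2 * M) ^ 2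
        + 20 * C₁ * M * (2 + C₁ ^ 2 + 2 * M) + 3 * M ^ 2)
  refine ⟨max B₁ (max B₂ B₃), fun F g h hFg hgc hgm ha => ?_⟩
  have hd0 : (0 : ℝ) ∈ Icc (-d) d := ⟨by linarith, hd.le⟩
  set a := g 0 with ha'
  have hF0 : F 0 0 = a ^ 2 := hFg 0 hd0
  have ha3 : 0 < a ^ 3 := by positivity
  -- If `a` is bounded below, the crude bounds on `F'` and `F''` suffice.
  rcases le_or_gt α a with hαa | hαa
  · refine le_trans ?_ (mul_le_mul_of_nonneg_right (le_max_left _ _) ha3.le)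
    have b1 := abs_le.1 (h.bound 1 (by simp) 0 hd0)
    have b2 := h.bound 2 (by simp) 0 hd0
    have e1 : |2 * F 0 0 * F 2 0| ≤ 2 * M / α * a ^ 3 := by
      rw [hF0, abs_mul, abs_of_pos (by positivity)]
      calc 2 * a ^ 2 * |F 2 0| ≤ 2 * a ^ 2 * M * 1 := by rw [mul_one]; gcongr
        _ ≤ 2 * a ^ 2 * M * (a / α) := by
          gcongr; rwa [one_le_div hα0]
        _ = _ := by field_simp
    have e2 : |F 1 0 ^ 2| ≤ M ^ 2 / α ^ 3 * a ^ 3 := by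
      rw [abs_of_nonneg (sq_nonneg _)]
      calc F 1 0 ^ 2 ≤ M ^ 2 * 1 := by rw [mul_one]; exact sq_le_sq' b1.1 b1.2
        _ ≤ M ^ 2 * (a / α) ^ 3 := by
          gcongr; exact one_le_pow₀ (by rwa [one_le_div hα0])
        _ = _ := by field_simp
    calc _ ≤ _ := abs_sub _ _
      _ ≤ _ := add_le_add e1 e2
      _ = B₁ * a ^ 3 := by ring
  -- The natural length scale is `√a`; the threshold `α = d² / 4` makes it smaller than `d / 2`.
  · set s := √a with hs
    have hs0 : 0 < s := Real.sqrt_pos.2 ha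
    have hs2 : s ^ 2 = a := Real.sq_sqrt ha.le
    have hsd : s < d / 2 := by
      refine lt_of_pow_lt_pow_left₀ 2 (by positivity) ?_
      rw [hs2]; calc a < α := hαa
        _ = _ := by rw [hα]; ring
    have hsI : -s ∈ Icc (-d) d := ⟨by linarith, by linarith⟩
    -- Either monotonicity traps `g` in `[0, a]` on `[-s, 0]`, so that `F ≤ s⁴` there, or `g` has a
    -- zero in that interval.
    rcases le_or_gt 0 (g (-s)) with hgs | hgs
    · refine le_trans ?_ (mul_le_mul_of_nonneg_right ((le_max_left _ _).trans (le_max_right _ _))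
        ha3.le)
      obtain ⟨i1, i2⟩ := h.interpolate hM hs0 (by linarith) (fun t ht => by
        have htI : t ∈ Icc (-d) d := ⟨by linarith [ht.1], by linarith [ht.2]⟩
        have g1 := hgm hsI htI ht.1
        have g2 := hgm htI hd0 ht.2
        rw [hFg t htI, show s ^ 4 = a ^ 2 by rw [← hs2]; ring]
        exact ⟨sq_nonneg _, pow_le_pow_left₀ (hgs.trans g1) g2 2⟩)
      have e1 : |2 * F 0 0 * F 2 0| ≤ 180 * (1 + M) * a ^ 3 := by
        rw [hF0, abs_mul, abs_of_pos (by positivity)]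
        calc 2 * a ^ 2 * |F 2 0| ≤ 2 * a ^ 2 * (90 * (1 + M) * s ^ 2) := by gcongr
          _ = _ := by rw [hs2]; ring
      have e2 : |F 1 0 ^ 2| ≤ (15 * (1 + M)) ^ 2 * a ^ 3 := by
        rw [abs_pow]
        calc |F 1 0| ^ 2 ≤ (15 * (1 + M) * s ^ 3) ^ 2 := by gcongr
          _ = _ := by rw [← hs2]; ring
      calc _ ≤ _ := abs_sub _ _
        _ ≤ _ := add_le_add e1 e2
        _ = B₂ * a ^ 3 := by ring
    · refine le_trans ?_ (mul_le_mul_of_nonneg_right ((le_max_right _ _).trans (le_max_right _ _))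
        ha3.le)
      obtain ⟨z, hz, hgz⟩ := intermediate_value_Icc (by linarith : -s ≤ 0)
        (hgc.mono (Icc_subset_Icc hsI.1 hd0.2)) ⟨hgs.le, ha.le⟩
      have hzI : z ∈ Icc (-d) d := ⟨by linarith [hz.1], by linarith [hz.2]⟩
      obtain ⟨f1, k, hk0, f2, γ, hγ, f3⟩ := h.third_le_of_zero hM hd (z := z)
        (by rw [abs_le]; constructor <;> linarith [hz.1, hz.2])
        (fun t ht => by rw [hFg t ht]; positivity) (by rw [hFg z hzI, hgz]; ring)
      have f0 : F 0 z = 0 := by rw [hFg z hzI, hgz]; ring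
      obtain ⟨σ, rfl⟩ : ∃ σ, z = -σ := ⟨-z, by ring⟩
      have hσ : 0 < σ := by
        rcases (show 0 ≤ σ by linarith [hz.2]).eq_or_lt with h0 | h0
        · rw [← h0, neg_zero] at hgz; linarith
        · exact h0
      obtain ⟨r2, r1, r0⟩ := h.taylor hM hzI hd0
      rw [show (0 : ℝ) - -σ = σ by ring, abs_of_pos hσ] at r0 r1 r2
      rw [f0, f1, f2, f3] at r0
      rw [f1, f2, f3] at r1
      rw [f2, f3] at r2
      -- `ρ₀`, `ρ₁`, `ρ₂` are the normalised Taylor remainders of `F`, `F'`, `F''` at the zero `-σ`.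
      obtain ⟨ρ₀, hρ₀⟩ : ∃ ρ, F 0 0 = (k * σ) ^ 2 + γ * (k * σ) * σ ^ 2 + ρ * (σ ^ 2) ^ 2 :=
        ⟨(F 0 0 - ((k * σ) ^ 2 + γ * (k * σ) * σ ^ 2)) / (σ ^ 2) ^ 2, by field_simp; ring⟩
      obtain ⟨ρ₁, hρ₁⟩ : ∃ ρ, F 1 0 = 2 * k ^ 2 * σ + 3 * k * γ * σ ^ 2 + ρ * σ ^ 3 :=
        ⟨(F 1 0 - (2 * k ^ 2 * σ + 3 * k * γ * σ ^ 2)) / σ ^ 3, by field_simp; ring⟩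
      obtain ⟨ρ₂, hρ₂⟩ : ∃ ρ, F 2 0 = 2 * k ^ 2 + 6 * k * γ * σ + ρ * σ ^ 2 :=
        ⟨(F 2 0 - (2 * k ^ 2 + 6 * k * γ * σ)) / σ ^ 2, by field_simp; ring⟩
      have q0 : |ρ₀| ≤ M := by
        rw [hρ₀, show (k * σ) ^ 2 + γ * (k * σ) * σ ^ 2 + ρ₀ * (σ ^ 2) ^ 2 -
          (0 + 0 * σ + 2 * k ^ 2 * σ ^ 2 / 2 + 6 * (k * γ) * σ ^ 3 / 6) = ρ₀ * σ ^ 4 by ring,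
          abs_mul, abs_of_pos (by positivity : 0 < σ ^ 4)] at r0
        exact le_of_mul_le_mul_right r0 (by positivity)
      have q1 : |ρ₁| ≤ M := by
        rw [hρ₁, show 2 * k ^ 2 * σ + 3 * k * γ * σ ^ 2 + ρ₁ * σ ^ 3 -
          (0 + 2 * k ^ 2 * σ + 6 * (k * γ) * σ ^ 2 / 2) = ρ₁ * σ ^ 3 by ring,
          abs_mul, abs_of_pos (by positivity : 0 < σ ^ 3)] at r1
        exact le_of_mul_le_mul_right r1 (by positivity)
      have q2 : |ρ₂| ≤ M := by
        rw [hρ₂, show 2 * k ^ 2 + 6 * k * γ * σ + ρ₂ * σ ^ 2 -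
          (2 * k ^ 2 + 6 * (k * γ) * σ) = ρ₂ * σ ^ 2 by ring,
          abs_mul, abs_of_pos (by positivity : 0 < σ ^ 2)] at r2
        exact le_of_mul_le_mul_right r2 (by positivity)
      have hσa : σ ^ 2 ≤ a := by
        rw [← hs2]; exact pow_le_pow_left₀ hσ.le (by linarith [hz.1]) 2
      refine (le_of_eq (congrArg _ ?_)).trans
        (near_zero_bound hM ha hk0 hσ.le hσa hγ q0 q1 q2 (by rw [← hF0, hρ₀]))
      rw [hρ₀, hρ₁, hρ₂]; ring

theorem exists_bound (M d : ℝ) (hM : 0 ≤ M) (hd : 0 < d) : ∃ C, ∀ (F : ℕ → ℝ → ℝ) (g : ℝ → ℝ),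
    IsBoundedChain F d M → (∀ t ∈ Icc (-d) d, F 0 t = g t ^ 2) → ContinuousOn g (Icc (-d) d) →
    MonotoneOn g (Icc (-d) d) → g 0 ≠ 0 → |2 * F 0 0 * F 2 0 - F 1 0 ^ 2| ≤ C * |g 0| ^ 3 := by
  obtain ⟨C, hC⟩ := exists_bound_of_pos M d hM hd
  refine ⟨C, fun F g h hFg hgc hgm hg0 => ?_⟩
  have hneg : ∀ t ∈ Icc (-d) d, -t ∈ Icc (-d) d := fun t ht => ⟨by linarith [ht.2], by linarith [ht.1]⟩
  rcases hg0.lt_or_gt with hlt | hgt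
  -- The reflection `t ↦ -g (-t)` is again monotone, and positive at `0`.
  · have := hC (fun j t => (-1) ^ j * F j (-t)) (fun t => -g (-t)) ⟨fun j hj t ht => ?_,
      fun j hj t ht => ?_⟩ (fun t ht => ?_) ?_ ?_ (by simpa using hlt)
    · rw [abs_of_neg hlt]; simpa using this
    · refine (((h.hasDerivAt j hj (-t) (hneg t ht)).scomp t (hasDerivAt_neg t)).const_mul
        ((-1 : ℝ) ^ j)).congr_deriv ?_
      simp [pow_succ]
    · rw [abs_mul, abs_pow, abs_neg, abs_one, one_pow, one_mul]
      exact h.bound j hj _ (hneg t ht)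
    · simp [hFg _ (hneg t ht)]
    · exact (hgc.comp continuousOn_neg hneg).neg
    · exact fun x hx y hy hxy => neg_le_neg (hgm (hneg y hy) (hneg x hx) (neg_le_neg hxy))
  · rw [abs_of_pos hgt]
    exact hC F g h hFg hgc hgm hgt

end IsBoundedChain

/-! ### Derivatives in the plane and along lines -/

theorem one_lt_rank_plane : 1 < Module.rank ℝ Plane :=
  Module.one_lt_rank_of_one_lt_finrank (by simp)

theorem sq_add_sq_pos {v : Plane} (hv : v ≠ 0) : 0 < v 0 ^ 2 + v 1 ^ 2 := by
  have := norm_pos_iff.2 hv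
  rwa [EuclideanSpace.norm_eq, Real.sqrt_pos, Fin.sum_univ_two, Real.norm_eq_abs, Real.norm_eq_abs,
    sq_abs, sq_abs] at this

/-- Currying is a linear isometry, so Lipschitz constants agree for iterated and for nested
derivatives. -/
theorem dist_iteratedFDeriv_two {E F : Type*} [NormedAddCommGroup E] [NormedSpace ℝ E]
    [NormedAddCommGroup F] [NormedSpace ℝ F] (f : E → F) (x y : E) :
    dist (iteratedFDeriv ℝ 2 f x) (iteratedFDeriv ℝ 2 f y)
      = dist (fderiv ℝ (fderiv ℝ f) x) (fderiv ℝ (fderiv ℝ f) y) := by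
  rw [iteratedFDeriv_succ_eq_comp_right, iteratedFDeriv_succ_eq_comp_right (x := y)]
  simp only [Function.comp_apply]
  rw [LinearIsometryEquiv.dist_map]
  rw [iteratedFDeriv_succ_eq_comp_left, iteratedFDeriv_zero_eq_comp]
  simp only [Function.comp_apply]
  rw [LinearIsometryEquiv.dist_map, LinearIsometryEquiv.comp_fderiv']
  set L := (continuousMultilinearCurryFin0 ℝ E (E →L[ℝ] F)).symm.toLinearIsometry
  exact (L.postcomp (E := E) (σ₁₂ := RingHom.id ℝ)).dist_map _ _

theorem dist_iteratedFDeriv_one {E F : Type*} [NormedAddCommGroup E] [NormedSpace ℝ E]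
    [NormedAddCommGroup F] [NormedSpace ℝ F] (f : E → F) (x y : E) :
    dist (iteratedFDeriv ℝ 1 f x) (iteratedFDeriv ℝ 1 f y) = dist (fderiv ℝ f x) (fderiv ℝ f y) := by
  rw [iteratedFDeriv_succ_eq_comp_right, iteratedFDeriv_succ_eq_comp_right (x := y)]
  simp only [Function.comp_apply, iteratedFDeriv_zero_eq_comp]
  rw [LinearIsometryEquiv.dist_map, LinearIsometryEquiv.dist_map]

section
variable {E F G : Type*} [NormedAddCommGroup E] [NormedSpace ℝ E] [NormedAddCommGroup F]
  [NormedSpace ℝ F] [NormedAddCommGroup G] [NormedSpace ℝ G]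

theorem hasDerivAt_line {Φ : E → F} {x v : E} {t : ℝ} (hd : DifferentiableAt ℝ Φ (x + t • v)) :
    HasDerivAt (fun t : ℝ => Φ (x + t • v)) (fderiv ℝ Φ (x + t • v) v) t := by
  have hline : HasDerivAt (fun t : ℝ => x + t • v) v t := by
    simpa using ((hasDerivAt_id' t).smul_const v).const_add x
  exact hd.hasFDerivAt.comp_hasDerivAt t hline

theorem hasDerivAt_line_apply {Φ : E → F →L[ℝ] G} {x v : E} {w : F} {t : ℝ}
    (hd : DifferentiableAt ℝ Φ (x + t • v)) :
    HasDerivAt (fun t : ℝ => Φ (x + t • v) w) (fderiv ℝ Φ (x + t • v) v w) t :=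
  (ContinuousLinearMap.apply ℝ G w).hasFDerivAt.comp_hasDerivAt t (hasDerivAt_line hd)

theorem hasDerivAt_line_apply_apply {Φ : E → F →L[ℝ] F →L[ℝ] G} {x v : E} {w w' : F} {t : ℝ}
    (hd : DifferentiableAt ℝ Φ (x + t • v)) :
    HasDerivAt (fun t : ℝ => Φ (x + t • v) w w') (fderiv ℝ Φ (x + t • v) v w w') t :=
  (ContinuousLinearMap.apply ℝ G w').hasFDerivAt.comp_hasDerivAt t (hasDerivAt_line_apply hd)

end

/-! ### Generic lines and extension across an isolated point -/

section Extension

variable {F : Type*} [NormedAddCommGroup F] [NormedSpace ℝ F]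

/-- A generic translate of a line avoids a countable set. -/
theorem frequently_line_disjoint {Z : Set Plane} (hZ : Z.Countable) (x : Plane) {v : Plane}
    (hv : v ≠ 0) : ∃ n : Plane, ∃ᶠ η in 𝓝 (0 : ℝ), ∀ t : ℝ, x + η • n + t • v ∉ Z := by
  obtain ⟨n, hn⟩ : ∃ n : Plane, ∃ φ : Plane →L[ℝ] ℝ, φ v = 0 ∧ φ n = 1 := by
    have hv2 := (sq_add_sq_pos hv).ne'
    -- `n` is `v` turned by a quarter turn, and the functional reads off the coordinate along `n`.
    refine ⟨!₂[-v 1, v 0], (v 0 ^ 2 + v 1 ^ 2)⁻¹ • (v 0 • EuclideanSpace.proj 1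
      - v 1 • EuclideanSpace.proj 0 : Plane →L[ℝ] ℝ), ?_, ?_⟩
    · simp; right; ring
    · simp; field_simp
  obtain ⟨φ, hφv, hφn⟩ := hn
  refine ⟨n, ?_⟩
  -- On the line shifted by `η • n` the function `φ (· - x)` is constantly `η`, so every `η` outside
  -- a countable set will do.
  have hc : ((fun z => φ (z - x)) '' Z).Countable := hZ.image _
  have hd := hc.dense_compl ℝ
  refine (mem_closure_iff_frequently.1 (hd 0)).mono fun η hη t hz => hη ⟨_, hz, ?_⟩
  simp [hφv, hφn]

/-- The punctured disc is not convex. The mean value inequality is applied on parallel segments that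
miss the origin, and the shift tends to zero. -/
theorem lipschitzOnWith_punctured_ball {Ψ : Plane → F} {ρ : ℝ} {C : NNReal}
    (hd : ∀ x ∈ Metric.ball (0 : Plane) ρ, x ≠ 0 → DifferentiableAt ℝ Ψ x)
    (hb : ∀ x ∈ Metric.ball (0 : Plane) ρ, x ≠ 0 → ‖fderiv ℝ Ψ x‖ ≤ C) :
    LipschitzOnWith C Ψ (Metric.ball 0 ρ \ {0}) := by
  refine LipschitzOnWith.of_dist_le_mul fun x hx y hy => ?_
  rcases eq_or_ne y x with rfl | hxy
  · simp
  obtain ⟨n, hn⟩ := frequently_line_disjoint (countable_singleton (0 : Plane)) x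
    (sub_ne_zero.2 hxy)
  have hU : IsOpen (Metric.ball (0 : Plane) ρ) := Metric.isOpen_ball
  have t1 : Filter.Tendsto (fun η : ℝ => x + η • n) (𝓝 0) (𝓝 x) := by
    have : Continuous fun η : ℝ => x + η • n := by fun_prop
    simpa using this.tendsto 0
  have t2 : Filter.Tendsto (fun η : ℝ => y + η • n) (𝓝 0) (𝓝 y) := by
    have : Continuous fun η : ℝ => y + η • n := by fun_prop
    simpa using this.tendsto 0
  have c1 := (hd x hx.1 hx.2).continuousAt.tendsto.comp t1
  have c2 := (hd y hy.1 hy.2).continuousAt.tendsto.comp t2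
  have c3 : Filter.Tendsto (fun η : ℝ => C * dist (x + η • n) (y + η • n)) (𝓝 0)
      (𝓝 (C * dist x y)) := (t1.dist t2).const_mul _
  have hev : ∃ᶠ η in 𝓝 (0 : ℝ), dist (Ψ (x + η • n)) (Ψ (y + η • n))
      ≤ C * dist (x + η • n) (y + η • n) := by
    refine (hn.and_eventually ((t1.eventually (hU.mem_nhds hx.1)).and
      (t2.eventually (hU.mem_nhds hy.1)))).mono ?_
    rintro η ⟨h1, h2, h3⟩
    have hseg : segment ℝ (y + η • n) (x + η • n) ⊆ Metric.ball (0 : Plane) ρ \ {0} := by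
      intro z hz
      refine ⟨(convex_ball _ _).segment_subset h3 h2 hz, ?_⟩
      rw [segment_symm, segment_eq_image'] at hz
      obtain ⟨t, -, rfl⟩ := hz
      convert h1 t using 3
      simp
    simpa [dist_eq_norm] using Convex.norm_image_sub_le_of_norm_fderiv_le (𝕜 := ℝ) (f := Ψ) (C := C)
      (fun z hz => hd z (hseg hz).1 (hseg hz).2) (fun z hz => hb z (hseg hz).1 (hseg hz).2)
      (convex_segment _ _) (left_mem_segment _ _ _) (right_mem_segment _ _ _)
  by_contra! hlt
  obtain ⟨η, h1, h2⟩ := (hev.and_eventually (c3.eventually_lt (c1.dist c2) hlt)).exists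
  exact absurd h1 (not_le.2 h2)

/-- A map with Lipschitz derivative off an isolated point is differentiable there, with Lipschitz
derivative. -/
theorem differentiable_of_punctured [FiniteDimensional ℝ F] {Φ : Plane → F} {ρ : ℝ} {C : NNReal}
    (hρ : 0 < ρ)
    (hc : ContinuousOn Φ (Metric.ball 0 ρ))
    (hd : ∀ x ∈ Metric.ball (0 : Plane) ρ, x ≠ 0 → DifferentiableAt ℝ Φ x)
    (hL : LipschitzOnWith C (fderiv ℝ Φ) (Metric.ball 0 ρ \ {0})) :
    (∀ x ∈ Metric.ball (0 : Plane) ρ, DifferentiableAt ℝ Φ x) ∧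
      ∃ K, LipschitzOnWith K (fderiv ℝ Φ) (Metric.ball 0 ρ) := by
  -- The value at the origin of a Lipschitz extension of the derivative is the candidate derivative
  -- there.
  obtain ⟨g, hg, hgE⟩ := hL.extend_finite_dimension
  set K := lipschitzExtensionConstant (Plane →L[ℝ] F) * C
  have h0 : (0 : Plane) ∈ Metric.ball (0 : Plane) ρ := Metric.mem_ball_self hρ
  have key : ∀ x ∈ Metric.ball (0 : Plane) ρ, ‖Φ x - Φ 0 - g 0 x‖ ≤ K * ‖x‖ * ‖x‖ := by
    intro x hx
    rcases eq_or_ne x 0 with rfl | hx0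
    · simp
    have hball : ∀ t ∈ Ioc (0 : ℝ) 1, t • x ∈ Metric.ball (0 : Plane) ρ \ {0} := by
      intro t ht
      refine ⟨?_, by simp [hx0, ht.1.ne']⟩
      rw [mem_ball_zero_iff] at hx ⊢
      rw [norm_smul, Real.norm_of_nonneg ht.1.le]
      nlinarith [norm_nonneg x, ht.2]
    -- The mean value inequality on the ray without its endpoint; continuity of `Φ` at the origin
    -- then allows `t → 0`.
    have hstep : ∀ t ∈ Ioc (0 : ℝ) 1,
        ‖Φ x - Φ (t • x) - g 0 (x - t • x)‖ ≤ K * ‖x‖ * ‖x - t • x‖ := by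
      intro t ht
      refine Convex.norm_image_sub_le_of_norm_hasFDerivWithin_le' (𝕜 := ℝ) (f := Φ)
        (f' := fderiv ℝ Φ)
        (s := (fun t : ℝ => t • x) '' Ioc 0 1) ?_ ?_ ?_ ⟨t, ht, rfl⟩ ⟨1, by simp, by simp⟩
      · rintro _ ⟨t, ht, rfl⟩
        exact (hd _ (hball t ht).1 (hball t ht).2).hasFDerivAt.hasFDerivWithinAt
      · rintro _ ⟨t, ht, rfl⟩
        rw [hgE (hball t ht), ← dist_eq_norm]
        refine (hg.dist_le_mul _ _).trans ?_
        rw [dist_zero_right, norm_smul, Real.norm_of_nonneg ht.1.le]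
        gcongr
        nlinarith [norm_nonneg x, ht.2]
      · exact (convex_Ioc 0 1).is_linear_image (IsLinearMap.isLinearMap_smul' x)
    have t0 : Filter.Tendsto (fun t : ℝ => t • x) (𝓝[>] 0) (𝓝 0) := by
      have : Continuous fun t : ℝ => t • x := by fun_prop
      simpa using (this.tendsto 0).mono_left nhdsWithin_le_nhds
    have t1 : Filter.Tendsto (fun t : ℝ => Φ (t • x)) (𝓝[>] 0) (𝓝 (Φ 0)) :=
      (hc.continuousAt (Metric.isOpen_ball.mem_nhds h0)).tendsto.comp t0
    have t2 : Filter.Tendsto (fun t : ℝ => x - t • x) (𝓝[>] 0) (𝓝 x) := by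
      simpa using t0.const_sub x
    have t3 := ((t1.const_sub (Φ x)).sub ((g 0).continuous.tendsto x |>.comp t2)).norm
    have t4 := t2.norm.const_mul (K * ‖x‖)
    refine le_of_tendsto_of_tendsto t3 t4 ?_
    filter_upwards [Ioc_mem_nhdsGT one_pos] with t ht using hstep t ht
  have hD0 : HasFDerivAt Φ (g 0) 0 := by
    rw [hasFDerivAt_iff_isLittleO_nhds_zero, Asymptotics.isLittleO_iff]
    intro c hc
    have : ∀ᶠ x in 𝓝 (0 : Plane), K * ‖x‖ < c := by
      have : Continuous fun x : Plane => (K : ℝ) * ‖x‖ := by fun_prop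
      have := this.tendsto 0
      rw [norm_zero, mul_zero] at this
      exact this.eventually_lt_const hc
    filter_upwards [this, Metric.isOpen_ball.mem_nhds h0] with x h1 h2
    rw [zero_add]
    refine (key x h2).trans ?_
    gcongr
  have hE : EqOn (fderiv ℝ Φ) g (Metric.ball 0 ρ) := by
    intro x hx
    rcases eq_or_ne x 0 with rfl | hx0
    · exact hD0.fderiv
    · exact hgE ⟨hx, hx0⟩
  refine ⟨fun x hx => ?_, K, ?_⟩
  · rcases eq_or_ne x 0 with rfl | hx0
    · exact hD0.differentiableAt
    · exact hd x hx hx0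
  · intro x hx y hy
    rw [hE hx, hE hy]
    exact hg x y

end Extension

/-! ### Partial derivatives and the curvature of a graph metric -/

section Pderiv

variable {F : Type*} [NormedAddCommGroup F] [NormedSpace ℝ F] {x : Plane}

theorem pderiv_congr {f h : Plane → F} (i : Fin 2) (hfh : f =ᶠ[𝓝 x] h) :
    pderiv i f =ᶠ[𝓝 x] pderiv i h := by
  filter_upwards [hfh.fderiv (𝕜 := ℝ)] with y hy
  rw [pderiv, pderiv, hy]

theorem pderiv_mul {f h : Plane → ℝ} (i : Fin 2) (hf : DifferentiableAt ℝ f x)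
    (hh : DifferentiableAt ℝ h x) :
    pderiv i (fun y => f y * h y) x = pderiv i f x * h x + f x * pderiv i h x := by
  simp only [pderiv, fderiv_fun_mul hf hh]
  simp; ring

theorem pderiv_add {f h : Plane → ℝ} (i : Fin 2) (hf : DifferentiableAt ℝ f x)
    (hh : DifferentiableAt ℝ h x) :
    pderiv i (fun y => f y + h y) x = pderiv i f x + pderiv i h x := by
  simp only [pderiv, fderiv_fun_add hf hh]
  simp

theorem contDiffAt_pderiv {f : Plane → F} {m n : WithTop ℕ∞} (hf : ContDiffAt ℝ n f x)
    (hmn : m + 1 ≤ n) (i : Fin 2) : ContDiffAt ℝ m (pderiv i f) x :=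
  (hf.fderiv_right hmn).clm_apply contDiffAt_const

theorem pderiv_pderiv {f : Plane → F} (hf : DifferentiableAt ℝ (fderiv ℝ f) x) (i j : Fin 2) :
    pderiv i (pderiv j f) x
      = fderiv ℝ (fderiv ℝ f) x (EuclideanSpace.single i 1) (EuclideanSpace.single j 1) := by
  have : pderiv j f = fun y => fderiv ℝ f y (EuclideanSpace.single j 1) := rfl
  rw [this, pderiv, fderiv_clm_apply hf (differentiableAt_const _)]
  simp

theorem pderiv_comm {f : Plane → F} (hf : ContDiffAt ℝ 2 f x) (i j : Fin 2) :
    pderiv i (pderiv j f) x = pderiv j (pderiv i f) x := by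
  have hd : DifferentiableAt ℝ (fderiv ℝ f) x :=
    (hf.fderiv_right (m := 1) (by norm_num)).differentiableAt (by norm_num)
  rw [pderiv_pderiv hd, pderiv_pderiv hd]
  exact (hf.isSymmSndFDerivAt (by simp)).eq _ _

end Pderiv

/-- The determinant `u_xx u_yy - u_xy²` of the Hessian. -/
noncomputable def hessDet (u : Plane → ℝ) (x : Plane) : ℝ :=
  pderiv 0 (pderiv 0 u) x * pderiv 1 (pderiv 1 u) x - pderiv 0 (pderiv 1 u) x ^ 2

/-- The metric of the graph of `u`. -/
noncomputable def graphMetric (u : Plane → ℝ) (i j : Fin 2) (x : Plane) : ℝ :=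
  (if i = j then 1 else 0) + pderiv i u x * pderiv j u x

section Curvature

variable {g : Plane → Matrix (Fin 2) (Fin 2) ℝ} {u : Plane → ℝ} {x : Plane}

theorem pderiv_metric (hu : ContDiffAt ℝ 2 u x)
    (hg : ∀ i j, (fun y => g y i j) =ᶠ[𝓝 x] graphMetric u i j) (k i j : Fin 2) :
    pderiv k (fun y => g y i j) x
      = pderiv k (pderiv i u) x * pderiv j u x + pderiv i u x * pderiv k (pderiv j u) x := by
  have hP : ∀ i, DifferentiableAt ℝ (pderiv i u) x := fun i =>
    (contDiffAt_pderiv hu (m := 1) (by norm_num) i).differentiableAt (by norm_num)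
  rw [(pderiv_congr k (hg i j)).self_of_nhds]
  unfold graphMetric
  rw [pderiv_add k (differentiableAt_const _) ((hP i).fun_mul (hP j)), pderiv_mul k (hP i) (hP j)]
  simp [pderiv]

theorem pderiv_pderiv_metric (hu : ContDiffAt ℝ 3 u x)
    (hg : ∀ i j, (fun y => g y i j) =ᶠ[𝓝 x] graphMetric u i j) (l k i j : Fin 2) :
    pderiv l (pderiv k (fun y => g y i j)) x
      = pderiv l (pderiv k (pderiv i u)) x * pderiv j u x
        + pderiv k (pderiv i u) x * pderiv l (pderiv j u) x
        + (pderiv l (pderiv i u) x * pderiv k (pderiv j u) x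
        + pderiv i u x * pderiv l (pderiv k (pderiv j u)) x) := by
  have hP : ∀ i, DifferentiableAt ℝ (pderiv i u) x := fun i =>
    (contDiffAt_pderiv hu (m := 2) (by norm_num) i).differentiableAt (by norm_num)
  have hH : ∀ k i, DifferentiableAt ℝ (pderiv k (pderiv i u)) x := fun k i =>
    (contDiffAt_pderiv (contDiffAt_pderiv hu (m := 2) (by norm_num) i) (m := 1) (by norm_num)
      k).differentiableAt (by norm_num)
  have he : pderiv k (fun y => g y i j) =ᶠ[𝓝 x] fun y =>
      pderiv k (pderiv i u) y * pderiv j u y + pderiv i u y * pderiv k (pderiv j u) y := by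
    filter_upwards [(hu.of_le (by norm_num : (2 : WithTop ℕ∞) ≤ 3)).eventually (by simp),
      (hg 0 0).eventuallyEq_nhds, (hg 0 1).eventuallyEq_nhds, (hg 1 0).eventuallyEq_nhds,
      (hg 1 1).eventuallyEq_nhds] with y h h00 h01 h10 h11
    refine pderiv_metric h (fun i j => ?_) k i j
    fin_cases i <;> fin_cases j <;> assumption
  rw [(pderiv_congr l he).self_of_nhds,
    pderiv_add l ((hH k i).fun_mul (hP j)) ((hP i).fun_mul (hH k j)), pderiv_mul l (hH k i) (hP j),
    pderiv_mul l (hP i) (hH k j)]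

theorem metric_eq (hg : ∀ i j, (fun y => g y i j) =ᶠ[𝓝 x] graphMetric u i j) :
    g x = !![1 + pderiv 0 u x ^ 2, pderiv 0 u x * pderiv 1 u x;
      pderiv 0 u x * pderiv 1 u x, 1 + pderiv 1 u x ^ 2] := by
  ext i j
  have := (hg i j).self_of_nhds
  simp only at this
  rw [this]
  fin_cases i <;> fin_cases j <;> simp [graphMetric] <;> ring

theorem christoffel_eq (hu : ContDiffAt ℝ 2 u x)
    (hg : ∀ i j, (fun y => g y i j) =ᶠ[𝓝 x] graphMetric u i j) (n i j : Fin 2) :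
    christoffel g n i j x
      = pderiv n u x * pderiv i (pderiv j u) x / (1 + pderiv 0 u x ^ 2 + pderiv 1 u x ^ 2) := by
  have hW : 0 < 1 + pderiv 0 u x ^ 2 + pderiv 1 u x ^ 2 := by positivity
  have hdet : (g x).det = 1 + pderiv 0 u x ^ 2 + pderiv 1 u x ^ 2 := by
    rw [metric_eq hg, Matrix.det_fin_two_of]; ring
  have h10 := pderiv_comm hu 1 0
  have hinv : (g x)⁻¹ = (1 + pderiv 0 u x ^ 2 + pderiv 1 u x ^ 2)⁻¹ •
      !![1 + pderiv 1 u x ^ 2, -(pderiv 0 u x * pderiv 1 u x);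
        -(pderiv 0 u x * pderiv 1 u x), 1 + pderiv 0 u x ^ 2] := by
    rw [Matrix.inv_def, hdet, Ring.inverse_eq_inv', metric_eq hg, Matrix.adjugate_fin_two_of]
  simp only [christoffel, Fin.sum_univ_two, hinv, pderiv_metric hu hg]
  fin_cases n <;> fin_cases i <;> fin_cases j <;> simp [h10] <;> field_simp <;> ring

/-- By symmetry of mixed partials the third derivatives of `u` cancel. With `W = 1 + |∇u|²` the
Christoffel terms contribute `-|∇u|² / W` times the Hessian determinant, leaving the factor `1 / W`;
the other one comes from `det g = W`. -/
theorem gaussCurvature_eq (hu : ContDiffAt ℝ 3 u x)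
    (hg : ∀ i j, (fun y => g y i j) =ᶠ[𝓝 x] graphMetric u i j) :
    gaussCurvature g x = hessDet u x / (1 + pderiv 0 u x ^ 2 + pderiv 1 u x ^ 2) ^ 2 := by
  have hW : 0 < 1 + pderiv 0 u x ^ 2 + pderiv 1 u x ^ 2 := by positivity
  have hdet : (g x).det = 1 + pderiv 0 u x ^ 2 + pderiv 1 u x ^ 2 := by
    rw [metric_eq hg, Matrix.det_fin_two_of]; ring
  have hu2 := hu.of_le (by norm_num : (2 : WithTop ℕ∞) ≤ 3)
  have h10 := pderiv_comm hu2 1 0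
  have hev : pderiv 1 (pderiv 0 u) =ᶠ[𝓝 x] pderiv 0 (pderiv 1 u) := by
    filter_upwards [hu2.eventually (by simp)] with y hy using pderiv_comm hy 1 0
  have t0 : pderiv 0 (pderiv 1 (pderiv 0 u)) x = pderiv 0 (pderiv 0 (pderiv 1 u)) x :=
    (pderiv_congr 0 hev).self_of_nhds
  have t1 : pderiv 1 (pderiv 1 (pderiv 0 u)) x = pderiv 1 (pderiv 0 (pderiv 1 u)) x :=
    (pderiv_congr 1 hev).self_of_nhds
  have t2 := pderiv_comm (contDiffAt_pderiv hu (m := 2) (by norm_num) 0) 1 0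
  have t3 := pderiv_comm (contDiffAt_pderiv hu (m := 2) (by norm_num) 1) 1 0
  rw [gaussCurvature, hdet]
  simp only [riemann, christoffel_eq hu2 hg, pderiv_pderiv_metric hu hg,
    Fin.sum_univ_two, metric_eq hg, hessDet]
  simp only [t2, t3, h10, t0, t1]
  simp
  field_simp
  ring

end Curvature

/-! ### Regularity off the critical points, and isolation of critical points -/

/-- A negative second derivative along a line would make the point a local maximum as well, hence
the function constant near it on that line. -/
theorem second_deriv_nonneg {f : Plane → ℝ} {q : Plane} (hf : ContDiffAt ℝ 2 f q)
    (hm : IsLocalMin f q) (n : Plane) : 0 ≤ fderiv ℝ (fderiv ℝ f) q n n := by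
  set φ : ℝ → ℝ := fun t => f (q + t • n) with hφ
  have hl : Continuous fun t : ℝ => q + t • n := by fun_prop
  have ht : Filter.Tendsto (fun t : ℝ => q + t • n) (𝓝 0) (𝓝 q) := by simpa using hl.tendsto 0
  have h1 : deriv φ =ᶠ[𝓝 0] fun t => fderiv ℝ f (q + t • n) n := by
    filter_upwards [ht.eventually (hf.eventually (by simp))] with t h
    exact (hasDerivAt_line (h.differentiableAt (by norm_num))).deriv
  have hd : DifferentiableAt ℝ (fderiv ℝ f) q :=
    (hf.fderiv_right (m := 1) (by norm_num)).differentiableAt (by norm_num)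
  have h2 : deriv (deriv φ) 0 = fderiv ℝ (fderiv ℝ f) q n n := by
    rw [h1.deriv_eq]
    rw [← show q + (0 : ℝ) • n = q by simp] at hd
    simpa using (hasDerivAt_line_apply (w := n) hd).deriv
  have hφm : IsLocalMin φ 0 := by
    filter_upwards [ht.eventually hm] with t h
    simpa [hφ] using h
  have hφc : ContinuousAt φ 0 := by
    have : ContinuousAt f (q + (0 : ℝ) • n) := by simpa using hf.continuousAt
    exact ContinuousAt.comp (f := fun t : ℝ => q + t • n) (x := 0) this hl.continuousAt
  by_contra! hneg
  rw [← h2] at hneg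
  have hmax := isLocalMax_of_deriv_deriv_neg hneg hφm.deriv_eq_zero hφc
  have hc : φ =ᶠ[𝓝 0] fun _ => φ 0 := by
    filter_upwards [hmax, hφm] with t h1 h2 using le_antisymm h1 h2
  have := hc.deriv.deriv_eq
  simp at this
  linarith

theorem fderiv_fderiv_linear_comb {f₁ f₂ f₃ : Plane → ℝ} {x : Plane} (h₁ : ContDiffAt ℝ 2 f₁ x)
    (h₂ : ContDiffAt ℝ 2 f₂ x) (h₃ : ContDiffAt ℝ 2 f₃ x) (a b c : ℝ) :
    fderiv ℝ (fderiv ℝ fun y => a * f₁ y + b * f₂ y + c * f₃ y) x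
      = a • fderiv ℝ (fderiv ℝ f₁) x + b • fderiv ℝ (fderiv ℝ f₂) x
        + c • fderiv ℝ (fderiv ℝ f₃) x := by
  have hd : ∀ {f : Plane → ℝ}, ContDiffAt ℝ 2 f x →
      HasFDerivAt (fderiv ℝ f) (fderiv ℝ (fderiv ℝ f) x) x := fun hf =>
    ((hf.fderiv_right (m := 1) (by norm_num)).differentiableAt (by norm_num)).hasFDerivAt
  have he : (fderiv ℝ fun y => a * f₁ y + b * f₂ y + c * f₃ y) =ᶠ[𝓝 x]
      fun y => a • fderiv ℝ f₁ y + b • fderiv ℝ f₂ y + c • fderiv ℝ f₃ y := by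
    filter_upwards [h₁.eventually (by simp), h₂.eventually (by simp),
      h₃.eventually (by simp)] with y e₁ e₂ e₃
    exact ((((e₁.differentiableAt (by norm_num)).hasFDerivAt.const_mul a).fun_add
      ((e₂.differentiableAt (by norm_num)).hasFDerivAt.const_mul b)).fun_add
      ((e₃.differentiableAt (by norm_num)).hasFDerivAt.const_mul c)).fderiv
  rw [he.fderiv_eq]
  exact ((((hd h₁).const_smul a).add ((hd h₂).const_smul b)).add ((hd h₃).const_smul c)).fderiv

/-- `g` is the `C⁴` metric of the graph of the `C¹` function `u` over the disc of radius `r`, with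
positive curvature off the critical point `0` of `u`. -/
structure IsPosGraph (r : ℝ) (g : Plane → Matrix (Fin 2) (Fin 2) ℝ) (u : Plane → ℝ) : Prop where
  pos : 0 < r
  contDiffOn : ContDiffOn ℝ 1 u (Metric.ball 0 r)
  metric_contDiffOn : ∀ i j, ContDiffOn ℝ 4 (fun p => g p i j) (Metric.ball 0 r)
  metric : ∀ x ∈ Metric.ball (0 : Plane) r, ∀ i j, g x i j = graphMetric u i j x
  curvature : ∀ x ∈ Metric.ball (0 : Plane) r, x ≠ 0 → 0 < gaussCurvature g x
  critical : fderiv ℝ u 0 = 0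

theorem fderiv_eq_pderiv (u : Plane → ℝ) (x : Plane) :
    fderiv ℝ u x = pderiv 0 u x • (EuclideanSpace.proj 0 : Plane →L[ℝ] ℝ)
      + pderiv 1 u x • (EuclideanSpace.proj 1 : Plane →L[ℝ] ℝ) := by
  ext v
  have hv : v = v 0 • EuclideanSpace.single 0 (1 : ℝ) + v 1 • EuclideanSpace.single 1 (1 : ℝ) := by
    ext i; fin_cases i <;> simp
  conv_lhs => rw [hv]
  simp only [map_add, map_smul]
  simp [pderiv]; ring

theorem fderiv_apply_eq (u : Plane → ℝ) (x v : Plane) :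
    fderiv ℝ u x v = v 0 * pderiv 0 u x + v 1 * pderiv 1 u x := by
  rw [fderiv_eq_pderiv]; simp; ring

/-- A degenerate symmetric bilinear form on the plane with kernel vector `n ≠ 0`. -/
theorem exists_eq_of_apply_eq_zero {A : Plane →L[ℝ] Plane →L[ℝ] ℝ} {n : Plane} (hn0 : n ≠ 0)
    (hs : ∀ v w, A v w = A w v) (hA : A n = 0) :
    ∃ m, A !₂[-n 1, n 0] !₂[-n 1, n 0] = m * (n 0 ^ 2 + n 1 ^ 2) ^ 2
      ∧ A (EuclideanSpace.single 0 1) (EuclideanSpace.single 0 1) = m * n 1 ^ 2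
      ∧ A (EuclideanSpace.single 1 1) (EuclideanSpace.single 0 1) = -m * (n 0 * n 1)
      ∧ A (EuclideanSpace.single 0 1) (EuclideanSpace.single 1 1) = -m * (n 0 * n 1)
      ∧ A (EuclideanSpace.single 1 1) (EuclideanSpace.single 1 1) = m * n 0 ^ 2 := by
  have hv : ∀ v : Plane, v = v 0 • EuclideanSpace.single 0 (1 : ℝ)
      + v 1 • EuclideanSpace.single 1 (1 : ℝ) := fun v => by
    ext i; fin_cases i <;> simp
  have hA' : ∀ v w, A v w = v 0 * (w 0 * A (EuclideanSpace.single 0 1) (EuclideanSpace.single 0 1)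
      + w 1 * A (EuclideanSpace.single 0 1) (EuclideanSpace.single 1 1))
      + v 1 * (w 0 * A (EuclideanSpace.single 0 1) (EuclideanSpace.single 1 1)
      + w 1 * A (EuclideanSpace.single 1 1) (EuclideanSpace.single 1 1)) := by
    intro v w
    conv_lhs => rw [hv v, hv w]
    simp only [map_add, map_smul, add_apply, smul_apply, smul_eq_mul,
      hs (EuclideanSpace.single 1 1) (EuclideanSpace.single 0 1)]
    ring
  have e0 : A n (EuclideanSpace.single 0 1) = 0 := by rw [hA]; rfl
  have e1 : A n (EuclideanSpace.single 1 1) = 0 := by rw [hA]; rfl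
  rw [hA' n] at e0 e1
  rw [hA' !₂[-n 1, n 0], hs (EuclideanSpace.single 1 1) (EuclideanSpace.single 0 1)]
  generalize A (EuclideanSpace.single 0 1) (EuclideanSpace.single 0 1) = a at *
  generalize A (EuclideanSpace.single 0 1) (EuclideanSpace.single 1 1) = b at *
  generalize A (EuclideanSpace.single 1 1) (EuclideanSpace.single 1 1) = c at *
  simp at e0 e1
  have hS := (sq_add_sq_pos hn0).ne'
  refine ⟨(a * n 1 ^ 2 - 2 * b * n 0 * n 1 + c * n 0 ^ 2) / (n 0 ^ 2 + n 1 ^ 2) ^ 2, ?_, ?_, ?_,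
    ?_, ?_⟩
  · field_simp; simp; ring
  · field_simp
    linear_combination (n 0 ^ 3 + 2 * n 0 * n 1 ^ 2) * e0 - n 0 ^ 2 * n 1 * e1
  · field_simp
    linear_combination n 1 ^ 3 * e0 + n 0 ^ 3 * e1
  · field_simp
    linear_combination n 1 ^ 3 * e0 + n 0 ^ 3 * e1
  · field_simp
    linear_combination (n 1 ^ 3 + 2 * n 0 ^ 2 * n 1) * e1 - n 0 * n 1 ^ 2 * e0

namespace IsPosGraph

variable {r : ℝ} {g : Plane → Matrix (Fin 2) (Fin 2) ℝ} {u : Plane → ℝ} {x : Plane}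

theorem neg (h : IsPosGraph r g u) : IsPosGraph r g (-u) where
  pos := h.pos
  contDiffOn := h.contDiffOn.neg
  metric_contDiffOn := h.metric_contDiffOn
  metric x hx i j := by
    rw [h.metric x hx i j]
    simp [graphMetric, pderiv, fderiv_neg]
  curvature := h.curvature
  critical := by rw [fderiv_neg, h.critical, neg_zero]

theorem metric_contDiffAt (h : IsPosGraph r g u) (hx : x ∈ Metric.ball 0 r) (i j : Fin 2) :
    ContDiffAt ℝ 4 (fun p => g p i j) x :=
  (h.metric_contDiffOn i j).contDiffAt (Metric.isOpen_ball.mem_nhds hx)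

theorem metric_eventuallyEq (h : IsPosGraph r g u) (hx : x ∈ Metric.ball 0 r) (i j : Fin 2) :
    (fun p => g p i j) =ᶠ[𝓝 x] graphMetric u i j := by
  filter_upwards [Metric.isOpen_ball.mem_nhds hx] with y hy using h.metric y hy i j

theorem differentiableAt (h : IsPosGraph r g u) (hx : x ∈ Metric.ball 0 r) :
    DifferentiableAt ℝ u x :=
  (h.contDiffOn.contDiffAt (Metric.isOpen_ball.mem_nhds hx)).differentiableAt (by norm_num)

theorem continuousOn_fderiv (h : IsPosGraph r g u) :
    ContinuousOn (fderiv ℝ u) (Metric.ball 0 r) :=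
  h.contDiffOn.continuousOn_fderiv_of_isOpen Metric.isOpen_ball le_rfl

theorem continuousAt_fderiv (h : IsPosGraph r g u) (hx : x ∈ Metric.ball 0 r) :
    ContinuousAt (fderiv ℝ u) x :=
  h.continuousOn_fderiv.continuousAt (Metric.isOpen_ball.mem_nhds hx)

theorem continuousAt_pderiv (h : IsPosGraph r g u) (hx : x ∈ Metric.ball 0 r) (i : Fin 2) :
    ContinuousAt (pderiv i u) x :=
  (h.continuousAt_fderiv hx).clm_apply continuousAt_const

/-- Here `g_ii - 1 = u_i²` is positive, and continuity of `u_i` fixes the sign of the square root.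
-/
theorem contDiffAt_pderiv_of_ne (h : IsPosGraph r g u) (hx : x ∈ Metric.ball 0 r) {i : Fin 2}
    (hi : pderiv i u x ≠ 0) : ContDiffAt ℝ 4 (pderiv i u) x := by
  have hsq : ∀ᶠ y in 𝓝 x, g y i i - 1 = pderiv i u y ^ 2 := by
    filter_upwards [h.metric_eventuallyEq hx i i] with y hy
    rw [hy, graphMetric]; simp; ring
  have hs : ContDiffAt ℝ 4 (fun y => √(g y i i - 1)) x := by
    refine ((h.metric_contDiffAt hx i i).sub contDiffAt_const).sqrt ?_
    rw [hsq.self_of_nhds]; positivity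
  rcases hi.lt_or_gt with hlt | hgt
  · refine hs.neg.congr_of_eventuallyEq ?_
    filter_upwards [hsq, (h.continuousAt_pderiv hx i).eventually_lt_const hlt] with y h1 h2
    rw [h1, Real.sqrt_sq_eq_abs, abs_of_neg h2, neg_neg]
  · refine hs.congr_of_eventuallyEq ?_
    filter_upwards [hsq, (h.continuousAt_pderiv hx i).eventually_const_lt hgt] with y h1 h2
    rw [h1, Real.sqrt_sq_eq_abs, abs_of_pos h2]

/-- Some partial derivative `u_i` is nonzero, hence `C⁴`; the other one is `g_ij / u_i`. -/
theorem contDiffAt_of_ne (h : IsPosGraph r g u) (hx : x ∈ Metric.ball 0 r)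
    (hne : fderiv ℝ u x ≠ 0) : ContDiffAt ℝ 5 u x := by
  obtain ⟨i, hi⟩ : ∃ i, pderiv i u x ≠ 0 := by
    by_contra! hc
    exact hne (by rw [fderiv_eq_pderiv, hc, hc]; simp)
  have hPi := h.contDiffAt_pderiv_of_ne hx hi
  have hP : ∀ j, ContDiffAt ℝ 4 (pderiv j u) x := by
    intro j
    by_cases hij : i = j
    · rwa [← hij]
    · refine ((h.metric_contDiffAt hx i j).div hPi hi).congr_of_eventuallyEq ?_
      filter_upwards [h.metric_eventuallyEq hx i j,
        (h.continuousAt_pderiv hx i).eventually_ne hi] with y h1 h2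
      rw [Pi.div_apply, h1, graphMetric, if_neg hij]
      field_simp; ring
  have hf : ContDiffAt ℝ 4 (fderiv ℝ u) x := by
    rw [funext (fderiv_eq_pderiv u)]
    exact ((hP 0).smul contDiffAt_const).add ((hP 1).smul contDiffAt_const)
  rw [show (5 : WithTop ℕ∞) = 4 + 1 by norm_num]
  refine contDiffAt_succ_iff_hasFDerivAt.2 ⟨fderiv ℝ u, ⟨Metric.ball 0 r,
    Metric.isOpen_ball.mem_nhds hx, fun y hy => (h.differentiableAt hy).hasFDerivAt⟩, hf⟩

theorem hessDet_pos (h : IsPosGraph r g u) (hx : x ∈ Metric.ball 0 r) (hne : fderiv ℝ u x ≠ 0) :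
    0 < hessDet u x := by
  have hx0 : x ≠ 0 := by rintro rfl; exact hne h.critical
  have := h.curvature x hx hx0
  rw [gaussCurvature_eq ((h.contDiffAt_of_ne hx hne).of_le (by norm_num))
    (h.metric_eventuallyEq hx)] at this
  have hW : 0 < 1 + pderiv 0 u x ^ 2 + pderiv 1 u x ^ 2 := by positivity
  exact (div_pos_iff_of_pos_right (by positivity)).1 this

theorem metric_quadratic (h : IsPosGraph r g u) (hx : x ∈ Metric.ball 0 r) (v : Plane) :
    v 0 ^ 2 * g x 0 0 + 2 * v 0 * v 1 * g x 0 1 + v 1 ^ 2 * g x 1 1 - (v 0 ^ 2 + v 1 ^ 2)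
      = fderiv ℝ u x v ^ 2 := by
  rw [h.metric x hx, h.metric x hx, h.metric x hx, fderiv_apply_eq]
  simp [graphMetric]; ring

theorem isLocalMin_quadratic (h : IsPosGraph r g u) (hx : x ∈ Metric.ball 0 r)
    (hP : fderiv ℝ u x = 0) (v : Plane) :
    IsLocalMin (fun y => v 0 ^ 2 * g y 0 0 + 2 * v 0 * v 1 * g y 0 1 + v 1 ^ 2 * g y 1 1) x := by
  filter_upwards [Metric.isOpen_ball.mem_nhds hx] with y hy
  have h1 := h.metric_quadratic hx v
  have h2 := h.metric_quadratic hy v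
  rw [hP] at h1
  simp only [zero_apply] at h1
  nlinarith [sq_nonneg (fderiv ℝ u y v)]

/-- At a critical point each form `vᵀ g v` attains its minimum `|v|²`; polarisation gives the
individual components. -/
theorem fderiv_metric_eq_zero (h : IsPosGraph r g u) (hx : x ∈ Metric.ball 0 r)
    (hP : fderiv ℝ u x = 0) (i j : Fin 2) : fderiv ℝ (fun p => g p i j) x = 0 := by
  have hd : ∀ i j, HasFDerivAt (fun p => g p i j) (fderiv ℝ (fun p => g p i j) x) x := fun i j =>
    ((h.metric_contDiffAt hx i j).differentiableAt (by norm_num)).hasFDerivAt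
  have key : ∀ v : Plane, v 0 ^ 2 • fderiv ℝ (fun p => g p 0 0) x
      + (2 * v 0 * v 1) • fderiv ℝ (fun p => g p 0 1) x
      + v 1 ^ 2 • fderiv ℝ (fun p => g p 1 1) x = 0 := fun v =>
    (h.isLocalMin_quadratic hx hP v).hasFDerivAt_eq_zero
      ((((hd 0 0).const_mul _).add ((hd 0 1).const_mul _)).add ((hd 1 1).const_mul _))
  have h00 : fderiv ℝ (fun p => g p 0 0) x = 0 := by simpa using key !₂[1, 0]
  have h11 : fderiv ℝ (fun p => g p 1 1) x = 0 := by simpa using key !₂[0, 1]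
  have h01 : fderiv ℝ (fun p => g p 0 1) x = 0 := by simpa [h00, h11] using key !₂[1, 1]
  have h10 : fderiv ℝ (fun p => g p 1 0) x = 0 := by
    rw [← h01]
    refine Filter.EventuallyEq.fderiv_eq ?_
    filter_upwards [h.metric_eventuallyEq hx 0 1, h.metric_eventuallyEq hx 1 0] with y h1 h2
    rw [h1, h2]; simp [graphMetric]; ring
  fin_cases i <;> fin_cases j <;> assumption

/-- Off the origin, critical points of `u` are isolated. -/
theorem eventually_fderiv_ne (h : IsPosGraph r g u) (hx : x ∈ Metric.ball 0 r) (hx0 : x ≠ 0)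
    (hP : fderiv ℝ u x = 0) : ∀ᶠ y in 𝓝[≠] x, fderiv ℝ u y ≠ 0 := by
  have hC : ∀ i j, ContDiffAt ℝ 2 (fun p => g p i j) x := fun i j =>
    (h.metric_contDiffAt hx i j).of_le (by norm_num)
  have hd : ∀ i j, DifferentiableAt ℝ (fderiv ℝ (fun p => g p i j)) x := fun i j =>
    ((hC i j).fderiv_right (m := 1) (by norm_num)).differentiableAt (by norm_num)
  set Ψ := fun i j => fderiv ℝ (fderiv ℝ (fun p => g p i j)) x with hΨ
  have hprod := (hd 0 0).hasFDerivAt.prodMk ((hd 0 1).hasFDerivAt.prodMk (hd 1 1).hasFDerivAt)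
  set L := (fderiv ℝ (fderiv ℝ (fun p => g p 0 0)) x).prod
    ((fderiv ℝ (fderiv ℝ (fun p => g p 0 1)) x).prod
      (fderiv ℝ (fderiv ℝ (fun p => g p 1 1)) x)) with hL
  -- A kernel vector `n` makes each `D²g_ij` a multiple `m_ij` of the square of the linear form
  -- orthogonal to `n`. Minimality of `nᵀ g n` at `x`, tested in the orthogonal direction, gives `∑
  -- m_ij n_i n_j ≥ 0`. But the Christoffel symbols vanish and `g = 1` at `x`, so the curvature is
  -- `-1/2` times this sum, contradicting positivity.
  have hinj : L.toLinearMap.ker = ⊥ := by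
    rw [LinearMap.ker_eq_bot']
    intro n hn
    by_contra hn0
    have hn' : Ψ 0 0 n = 0 ∧ Ψ 0 1 n = 0 ∧ Ψ 1 1 n = 0 := by
      simpa [hL, Prod.ext_iff] using hn
    have hQ := second_deriv_nonneg ((((hC 0 0).const_smul (n 0 ^ 2)).add
      ((hC 0 1).const_smul (2 * n 0 * n 1))).add ((hC 1 1).const_smul (n 1 ^ 2)))
      (h.isLocalMin_quadratic hx hP n) !₂[-n 1, n 0]
    have hcomb := fderiv_fderiv_linear_comb (hC 0 0) (hC 0 1) (hC 1 1) (n 0 ^ 2) (2 * n 0 * n 1)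
      (n 1 ^ 2)
    replace hQ := hQ.trans_eq (congrArg (fun A => A !₂[-n 1, n 0] !₂[-n 1, n 0]) hcomb)
    have hR := h.curvature x hx hx0
    have hch : ∀ n i j, christoffel g n i j x = 0 := fun n i j => by
      simp [christoffel, pderiv, h.fderiv_metric_eq_zero hx hP]
    have hg1 : g x = 1 := by
      rw [metric_eq (h.metric_eventuallyEq hx)]
      ext i j
      fin_cases i <;> fin_cases j <;> simp [pderiv, hP]
    have hsym : pderiv 0 (pderiv 1 fun p => g p 1 0) x = pderiv 0 (pderiv 1 fun p => g p 0 1) x := by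
      refine (pderiv_congr 0 (pderiv_congr 1 ?_)).self_of_nhds
      filter_upwards [h.metric_eventuallyEq hx 0 1, h.metric_eventuallyEq hx 1 0] with y h1 h2
      rw [h1, h2]; simp [graphMetric]; ring
    simp only [gaussCurvature, riemann, hg1, hch, Matrix.det_one, hsym] at hR
    simp only [pderiv_pderiv (hd _ _)] at hR
    have key : ∀ i j, Ψ i j n = 0 → _ := fun i j hij => exists_eq_of_apply_eq_zero hn0
      (fun v w => ((hC i j).isSymmSndFDerivAt (by simp)).eq v w) hij
    obtain ⟨m₀, q₀, -, -, -, s₀⟩ := key 0 0 hn'.1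
    obtain ⟨m₁, q₁, -, t₁, t₁', -⟩ := key 0 1 hn'.2.1
    obtain ⟨m₂, q₂, s₂, -, -, -⟩ := key 1 1 hn'.2.2
    simp only [add_apply, smul_apply, smul_eq_mul] at hQ
    simp only at q₀ q₁ q₂ s₀ t₁ t₁' s₂
    rw [q₀, q₁, q₂] at hQ
    rw [s₀, t₁, t₁', s₂] at hR
    have hQ' : 0 ≤ (n 0 ^ 2 + n 1 ^ 2) ^ 2
      * (n 0 ^ 2 * m₀ + 2 * n 0 * n 1 * m₁ + n 1 ^ 2 * m₂) := by linarith
    simp at hR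
    have := nonneg_of_mul_nonneg_right hQ' (pow_pos (sq_add_sq_pos hn0) 2)
    linarith
  -- As their derivative at `x` is injective, the first derivatives of the metric cannot all vanish
  -- again near `x`, as they would at another critical point.
  obtain ⟨K, -, hK⟩ := LinearMap.exists_antilipschitzWith L.toLinearMap hinj
  filter_upwards [hprod.eventually_ne (c := 0) ⟨K, hK⟩,
    mem_nhdsWithin_of_mem_nhds (Metric.isOpen_ball.mem_nhds hx)] with y hy hyb hPy
  exact hy (by simp [h.fderiv_metric_eq_zero hyb hPy])

end IsPosGraph

/-! ### Convexity from positive curvature -/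

/-- The gradient of `u` is a monotone map on the disc of radius `r`: `u` is convex there. -/
def HasMonotoneGradient (r : ℝ) (u : Plane → ℝ) : Prop :=
  ∀ x ∈ Metric.ball (0 : Plane) r, ∀ y ∈ Metric.ball (0 : Plane) r,
    fderiv ℝ u x (y - x) ≤ fderiv ℝ u y (y - x)

theorem isPreconnected_ball_diff_countable {r : ℝ} (hr : 0 < r) {Z : Set Plane}
    (hZ : Z.Countable) : IsPreconnected (Metric.ball (0 : Plane) r \ Z) := by
  set e := OpenPartialHomeomorph.univBall (0 : Plane) r
  have hinj : Function.Injective e := by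
    have := e.injOn
    rwa [OpenPartialHomeomorph.univBall_source, injOn_univ] at this
  have hc := (hZ.preimage hinj).isConnected_compl_of_one_lt_rank one_lt_rank_plane
  have : Metric.ball (0 : Plane) r \ Z = e '' (e ⁻¹' Z)ᶜ := by
    have hrange : range e = Metric.ball (0 : Plane) r := by
      rw [← image_univ, ← OpenPartialHomeomorph.univBall_source (0 : Plane) r,
        e.image_source_eq_target, OpenPartialHomeomorph.univBall_target _ hr]
    rw [← preimage_compl, image_preimage_eq_inter_range, hrange, sdiff_eq, inter_comm]
  rw [this]
  exact hc.isPreconnected.image _ (OpenPartialHomeomorph.continuous_univBall _ _).continuousOn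

namespace IsPosGraph

variable {r : ℝ} {g : Plane → Matrix (Fin 2) (Fin 2) ℝ} {u : Plane → ℝ} {x : Plane}

theorem countable_critical (h : IsPosGraph r g u) :
    {x ∈ Metric.ball (0 : Plane) r | fderiv ℝ u x = 0}.Countable := by
  set S := {x ∈ Metric.ball (0 : Plane) r | fderiv ℝ u x = 0} \ {0} with hS
  have : DiscreteTopology S := by
    rw [discreteTopology_subtype_iff]
    intro x hx
    rw [← disjoint_iff, Filter.disjoint_principal_right]
    filter_upwards [h.eventually_fderiv_ne hx.1.1 hx.2 hx.1.2] with y hy hyS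
    exact hy hyS.1.2
  have hc : S.Countable := countable_of_Lindelof_of_discrete
  exact (hc.insert 0).mono (by rw [hS, insert_sdiff_singleton]; exact subset_insert _ _)

theorem hessian_apply (h : IsPosGraph r g u) (hx : x ∈ Metric.ball 0 r)
    (hne : fderiv ℝ u x ≠ 0) (v : Plane) :
    fderiv ℝ (fderiv ℝ u) x v v = v 0 ^ 2 * pderiv 0 (pderiv 0 u) x
      + 2 * v 0 * v 1 * pderiv 0 (pderiv 1 u) x + v 1 ^ 2 * pderiv 1 (pderiv 1 u) x := by
  have hC := (h.contDiffAt_of_ne hx hne).of_le (show (2 : WithTop ℕ∞) ≤ 5 by norm_num)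
  have hd : DifferentiableAt ℝ (fderiv ℝ u) x :=
    (hC.fderiv_right (m := 1) (by norm_num)).differentiableAt (by norm_num)
  have hv : v = v 0 • EuclideanSpace.single 0 (1 : ℝ) + v 1 • EuclideanSpace.single 1 (1 : ℝ) := by
    ext i; fin_cases i <;> simp
  have hs := pderiv_comm hC 1 0
  conv_lhs => rw [hv]
  simp only [map_add, map_smul, add_apply, smul_apply, smul_eq_mul, ← pderiv_pderiv hd, hs]
  ring

/-- A segment may meet the critical set, where `u` need not have a Hessian. Generic parallel
segments avoid this countable set, the Hessian is positive along them, and continuity of the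
gradient passes to the limit. -/
theorem monotone_of_hessian (h : IsPosGraph r g u)
    (hp : ∀ x ∈ Metric.ball (0 : Plane) r, fderiv ℝ u x ≠ 0 → 0 < pderiv 0 (pderiv 0 u) x) :
    HasMonotoneGradient r u := by
  intro x hx y hy
  rcases eq_or_ne y x with rfl | hxy
  · simp
  set v := y - x with hv
  obtain ⟨n, hn⟩ := frequently_line_disjoint h.countable_critical x (sub_ne_zero.2 hxy)
  have t1 : Filter.Tendsto (fun η : ℝ => x + η • n) (𝓝 0) (𝓝 x) := by
    have : Continuous fun η : ℝ => x + η • n := by fun_prop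
    simpa using this.tendsto 0
  have t2 : Filter.Tendsto (fun η : ℝ => y + η • n) (𝓝 0) (𝓝 y) := by
    have : Continuous fun η : ℝ => y + η • n := by fun_prop
    simpa using this.tendsto 0
  have c : ∀ z ∈ Metric.ball (0 : Plane) r, ContinuousAt (fun w => fderiv ℝ u w v) z := fun z hz =>
    (h.continuousAt_fderiv hz).clm_apply continuousAt_const
  by_contra! hlt
  obtain ⟨η, h1, h2, h3, h4⟩ := (hn.and_eventually ((((c y hy).tendsto.comp t2).eventually_lt
    ((c x hx).tendsto.comp t1) hlt).and ((t1.eventually (Metric.isOpen_ball.mem_nhds hx)).and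
    (t2.eventually (Metric.isOpen_ball.mem_nhds hy))))).exists
  have hball : ∀ t ∈ Icc (0 : ℝ) 1, x + η • n + t • v ∈ Metric.ball (0 : Plane) r := by
    intro t ht
    have := (convex_ball (0 : Plane) r).add_smul_sub_mem h3 h4 ht
    convert this using 3
    simp [hv]
  have hne : ∀ t ∈ Icc (0 : ℝ) 1, fderiv ℝ u (x + η • n + t • v) ≠ 0 := fun t ht h0 =>
    h1 t ⟨hball t ht, h0⟩
  have hder : ∀ t ∈ Icc (0 : ℝ) 1, HasDerivAt (fun t : ℝ => fderiv ℝ u (x + η • n + t • v) v)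
      (fderiv ℝ (fderiv ℝ u) (x + η • n + t • v) v v) t := by
    intro t ht
    have hC := h.contDiffAt_of_ne (hball t ht) (hne t ht)
    have hd : DifferentiableAt ℝ (fderiv ℝ u) (x + η • n + t • v) :=
      (hC.fderiv_right (m := 1) (by norm_num)).differentiableAt (by norm_num)
    exact hasDerivAt_line_apply hd
  have hmono : MonotoneOn (fun t : ℝ => fderiv ℝ u (x + η • n + t • v) v) (Icc 0 1) := by
    refine monotoneOn_of_hasDerivWithinAt_nonneg (convex_Icc 0 1)
      (fun t ht => (hder t ht).continuousAt.continuousWithinAt)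
      (fun t ht => (hder t (interior_subset ht)).hasDerivWithinAt) fun t ht => ?_
    replace ht := interior_subset ht
    rw [h.hessian_apply (hball t ht) (hne t ht)]
    have hp := hp _ (hball t ht) (hne t ht)
    have hD := h.hessDet_pos (hball t ht) (hne t ht)
    rw [hessDet] at hD
    generalize pderiv 0 (pderiv 0 u) (x + η • n + t • v) = a at *
    generalize pderiv 0 (pderiv 1 u) (x + η • n + t • v) = b at *
    generalize pderiv 1 (pderiv 1 u) (x + η • n + t • v) = c at *
    -- Completing the square: `a` times the Hessian form is `(v₀ a + v₁ b)² + (ac - b²) v₁²`.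
    refine nonneg_of_mul_nonneg_right (a := a) ?_ hp
    nlinarith [sq_nonneg (v 0 * a + v 1 * b), mul_nonneg hD.le (sq_nonneg (v 1))]
  have := hmono (by simp) (by simp) zero_le_one
  simp only [zero_smul, add_zero, one_smul] at this
  rw [show x + η • n + v = y + η • n by rw [hv]; abel] at this
  exact absurd h2 (not_lt.2 this)

/-- Where the Hessian determinant is positive `u_xx` cannot vanish, so it keeps one sign on the
connected complement of the critical set. -/
theorem hasMonotoneGradient_or (h : IsPosGraph r g u) :
    HasMonotoneGradient r u ∨ HasMonotoneGradient r (-u) := by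
  set Z := {x ∈ Metric.ball (0 : Plane) r | fderiv ℝ u x = 0}
  have hmem : ∀ x, x ∈ Metric.ball (0 : Plane) r \ Z ↔
      x ∈ Metric.ball (0 : Plane) r ∧ fderiv ℝ u x ≠ 0 := fun x =>
    ⟨fun hx => ⟨hx.1, fun h0 => hx.2 ⟨hx.1, h0⟩⟩, fun hx => ⟨hx.1, fun h0 => hx.2 h0.2⟩⟩
  have hpre := isPreconnected_ball_diff_countable h.pos h.countable_critical
  have hc : ContinuousOn (pderiv 0 (pderiv 0 u)) (Metric.ball (0 : Plane) r \ Z) := by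
    intro x hx
    rw [hmem] at hx
    exact (contDiffAt_pderiv (contDiffAt_pderiv (h.contDiffAt_of_ne hx.1 hx.2) (m := 4)
      (by norm_num) 0) (m := 3) (by norm_num) 0).continuousAt.continuousWithinAt
  have hne : ∀ x ∈ Metric.ball (0 : Plane) r \ Z, pderiv 0 (pderiv 0 u) x ≠ 0 := by
    intro x hx h0
    have := h.hessDet_pos ((hmem x).1 hx).1 ((hmem x).1 hx).2
    rw [hessDet, h0] at this
    nlinarith [sq_nonneg (pderiv 0 (pderiv 1 u) x)]
  by_cases hpos : ∀ x ∈ Metric.ball (0 : Plane) r \ Z, 0 < pderiv 0 (pderiv 0 u) x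
  · exact Or.inl (h.monotone_of_hessian fun x hx hx' => hpos x ((hmem x).2 ⟨hx, hx'⟩))
  · push Not at hpos
    obtain ⟨x₁, hx₁, hlt⟩ := hpos
    refine Or.inr (h.neg.monotone_of_hessian fun x hx hx' => ?_)
    have hxZ : x ∈ Metric.ball (0 : Plane) r \ Z :=
      (hmem x).2 ⟨hx, fun h0 => hx' (by rw [fderiv_neg, h0, neg_zero])⟩
    have e : pderiv 0 (pderiv 0 (-u)) x = -pderiv 0 (pderiv 0 u) x := by
      have : pderiv 0 (-u) = -pderiv 0 u := by
        ext y; simp [pderiv, fderiv_neg]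
      rw [this]; simp [pderiv, fderiv_neg]
    rw [e]
    by_contra! hle
    obtain ⟨z, hz, hz0⟩ := hpre.intermediate_value hx₁ hxZ hc ⟨hlt, by linarith⟩
    exact hne z hz hz0

section Convex

theorem fderiv_le_sub (h : IsPosGraph r g u) (hm : HasMonotoneGradient r u) {y : Plane}
    (hx : x ∈ Metric.ball 0 r) (hy : y ∈ Metric.ball 0 r) :
    fderiv ℝ u x (y - x) ≤ u y - u x := by
  have hball : ∀ t ∈ Icc (0 : ℝ) 1, x + t • (y - x) ∈ Metric.ball (0 : Plane) r := fun t ht =>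
    (convex_ball (0 : Plane) r).add_smul_sub_mem hx hy ht
  have hder : ∀ t ∈ Icc (0 : ℝ) 1, HasDerivAt (fun t : ℝ => u (x + t • (y - x)))
      (fderiv ℝ u (x + t • (y - x)) (y - x)) t := by
    intro t ht
    exact hasDerivAt_line (h.differentiableAt (hball t ht))
  obtain ⟨t, ht, he⟩ := exists_hasDerivAt_eq_slope (fun t : ℝ => u (x + t • (y - x))) _ zero_lt_one
    (fun t ht => (hder t ht).continuousAt.continuousWithinAt)
    (fun t ht => hder t (Ioo_subset_Icc_self ht))
  simp only [zero_smul, one_smul, add_zero, add_sub_cancel, sub_zero, div_one] at he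
  rw [← he]
  have := hm x hx _ (hball t (Ioo_subset_Icc_self ht))
  simp only [add_sub_cancel_left, map_smul, smul_eq_mul] at this
  exact le_of_mul_le_mul_left this ht.1

theorem apply_zero_le (h : IsPosGraph r g u) (hm : HasMonotoneGradient r u)
    (hx : x ∈ Metric.ball 0 r) : u 0 ≤ u x := by
  have := h.fderiv_le_sub hm (Metric.mem_ball_self h.pos) hx
  rw [h.critical] at this
  simp at this
  linarith

theorem fderiv_eq_zero_of_apply_eq (h : IsPosGraph r g u) (hm : HasMonotoneGradient r u)
    (hx : x ∈ Metric.ball 0 r) (hux : u x ≤ u 0) : fderiv ℝ u x = 0 := by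
  refine IsLocalMin.fderiv_eq_zero ?_
  filter_upwards [Metric.isOpen_ball.mem_nhds hx] with y hy
  exact hux.trans (h.apply_zero_le hm hy)

/-- A second critical point would be another minimiser; by convexity the whole segment to the origin
would be critical, against isolation. -/
theorem fderiv_ne_zero (h : IsPosGraph r g u) (hm : HasMonotoneGradient r u)
    (hx : x ∈ Metric.ball 0 r) (hx0 : x ≠ 0) : fderiv ℝ u x ≠ 0 := by
  intro hP
  have h0 := Metric.mem_ball_self (x := (0 : Plane)) h.pos
  have hxx : u x ≤ u 0 := by
    have := h.fderiv_le_sub hm hx h0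
    rw [hP] at this
    simp at this
    linarith
  have hball : ∀ t ∈ Icc (0 : ℝ) 1, t • x ∈ Metric.ball (0 : Plane) r := fun t ht => by
    have := (convex_ball (0 : Plane) r).add_smul_sub_mem h0 hx ht
    simpa using this
  have hseg : ∀ t ∈ Icc (0 : ℝ) 1, fderiv ℝ u (t • x) = 0 := by
    intro t ht
    refine h.fderiv_eq_zero_of_apply_eq hm (hball t ht) ?_
    have e1 := h.fderiv_le_sub hm (hball t ht) h0
    have e2 := h.fderiv_le_sub hm (hball t ht) hx
    rw [zero_sub, map_neg, map_smul, smul_eq_mul] at e1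
    rw [show x - t • x = (1 - t) • x by rw [sub_smul, one_smul], map_smul, smul_eq_mul] at e2
    nlinarith [ht.1, ht.2]
  have hev := h.eventually_fderiv_ne hx hx0 hP
  have ht : Filter.Tendsto (fun t : ℝ => t • x) (𝓝[<] 1) (𝓝[≠] x) := by
    refine tendsto_nhdsWithin_iff.2 ⟨?_, ?_⟩
    · have : Continuous fun t : ℝ => t • x := by fun_prop
      simpa using (this.tendsto 1).mono_left nhdsWithin_le_nhds
    · filter_upwards [self_mem_nhdsWithin] with t ht hEq
      have : (t - 1) • x = 0 := by rw [sub_smul, hEq, one_smul, sub_self]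
      rcases smul_eq_zero.1 this with h1 | h1
      · exact (mem_Iio.1 ht).ne (sub_eq_zero.1 h1)
      · exact hx0 h1
  obtain ⟨t, h1, h2⟩ := ((ht.eventually hev).and (Ioo_mem_nhdsLT zero_lt_one)).exists
  exact h1 (hseg t (Ioo_subset_Icc_self h2))

theorem fderiv_self_pos (h : IsPosGraph r g u) (hm : HasMonotoneGradient r u)
    (hx : x ∈ Metric.ball 0 r) (hx0 : x ≠ 0) : 0 < fderiv ℝ u x x := by
  have h0 := Metric.mem_ball_self (x := (0 : Plane)) h.pos
  have e1 := h.fderiv_le_sub hm hx h0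
  rw [zero_sub, map_neg] at e1
  by_contra! hle
  exact h.fderiv_ne_zero hm hx hx0 (h.fderiv_eq_zero_of_apply_eq hm hx (by linarith))

/-- By monotonicity the radial derivative does not decrease along rays, so its minimum over the
sphere of radius `δ` is a lower bound up to the boundary. -/
theorem exists_lower_bound (h : IsPosGraph r g u) (hm : HasMonotoneGradient r u) {δ : ℝ}
    (hδ : 0 < δ) (hδr : δ < r) :
    ∃ c > 0, ∀ x ∈ Metric.ball (0 : Plane) r, δ ≤ ‖x‖ → c ≤ ‖fderiv ℝ u x‖ := by
  have hsub : Metric.sphere (0 : Plane) δ ⊆ Metric.ball 0 r := fun x hx => by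
    rw [mem_sphere_zero_iff_norm] at hx
    rw [mem_ball_zero_iff, hx]; exact hδr
  obtain ⟨y₀, hy₀, hmin⟩ := (isCompact_sphere (0 : Plane) δ).exists_isMinOn
    (NormedSpace.sphere_nonempty.2 hδ.le)
    (f := fun y => fderiv ℝ u y y) ((h.continuousOn_fderiv.mono hsub).clm_apply continuousOn_id)
  have hy₀0 : y₀ ≠ 0 := by
    rintro rfl
    rw [mem_sphere_zero_iff_norm, norm_zero] at hy₀
    exact hδ.ne hy₀
  refine ⟨fderiv ℝ u y₀ y₀ / δ, div_pos (h.fderiv_self_pos hm (hsub hy₀) hy₀0) hδ,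
    fun x hx hxδ => ?_⟩
  have hxn : 0 < ‖x‖ := hδ.trans_le hxδ
  set y := (δ / ‖x‖) • x with hy
  have hyS : y ∈ Metric.sphere (0 : Plane) δ := by
    rw [mem_sphere_zero_iff_norm, hy, norm_smul, Real.norm_of_nonneg (by positivity)]
    field_simp
  have h1 : fderiv ℝ u y₀ y₀ ≤ fderiv ℝ u y y := hmin hyS
  have h2 : fderiv ℝ u y x ≤ fderiv ℝ u x x := by
    rcases hxδ.eq_or_lt with he | hlt
    · have : y = x := by rw [hy, he, div_self hxn.ne', one_smul]
      rw [this]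
    · have := hm y (hsub hyS) x hx
      rw [show x - y = (1 - δ / ‖x‖) • x by rw [sub_smul, one_smul], map_smul, map_smul,
        smul_eq_mul, smul_eq_mul] at this
      exact le_of_mul_le_mul_left this (by rw [sub_pos, div_lt_one hxn]; exact hlt)
  have h3 : fderiv ℝ u y y = δ / ‖x‖ * fderiv ℝ u y x := by
    conv_lhs => rw [hy, map_smul, ← hy, smul_eq_mul]
  have h4 : fderiv ℝ u x x ≤ ‖fderiv ℝ u x‖ * ‖x‖ :=
    (le_abs_self _).trans ((fderiv ℝ u x).le_opNorm x)
  rw [div_le_iff₀ hδ]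
  calc _ ≤ δ / ‖x‖ * fderiv ℝ u y x := h1.trans h3.le
    _ ≤ δ / ‖x‖ * (‖fderiv ℝ u x‖ * ‖x‖) := by gcongr; exact h2.trans h4
    _ = _ := by field_simp

end Convex

end IsPosGraph

/-! ### Trilinear forms and jets along lines -/

/-- A symmetric trilinear form on the plane is controlled by its values on four cubes. -/
theorem norm_trilinear_le {T : Plane →L[ℝ] Plane →L[ℝ] Plane →L[ℝ] ℝ} {B p q : ℝ}
    (hpq : p ^ 2 + q ^ 2 = 1) (h12 : ∀ a b c, T a b c = T b a c) (h23 : ∀ a b c, T a b c = T a c b)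
    (hB : ∀ k : ℝ, |k| ≤ 2 → |T (!₂[p, q] + k • !₂[-q, p]) (!₂[p, q] + k • !₂[-q, p])
      (!₂[p, q] + k • !₂[-q, p])| ≤ B) : ‖T‖ ≤ 16 * B := by
  set ν : Plane := !₂[p, q]
  set τ : Plane := !₂[-q, p]
  have hexp : ∀ k : ℝ, T (ν + k • τ) (ν + k • τ) (ν + k • τ)
      = T ν ν ν + 3 * k * T ν ν τ + 3 * k ^ 2 * T ν τ τ + k ^ 3 * T τ τ τ := by
    intro k
    simp only [map_add, map_smul, add_apply, smul_apply, smul_eq_mul]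
    rw [h23 ν τ ν, h12 τ ν ν, h23 ν τ ν, h12 τ ν τ, h23 τ τ ν, h12 τ ν τ]
    ring
  -- Four values determine a cubic in `k`, and each of the four components of `T` comes out at most
  -- `2 * B`. Expanding `T a b c` yields eight terms, hence `16 * B`.
  have k0 := abs_le.1 (hB 0 (by norm_num))
  have k1 := abs_le.1 (hB 1 (by norm_num))
  have k2 := abs_le.1 (hB (-1) (by norm_num))
  have k3 := abs_le.1 (hB 2 (by norm_num))
  rw [hexp] at k0 k1 k2 k3
  have b0 : |T ν ν ν| ≤ 2 * B := by rw [abs_le]; constructor <;> linarith [k0.1, k0.2]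
  have b1 : |T ν ν τ| ≤ 2 * B := by
    rw [abs_le]; constructor <;> linarith [k0.1, k0.2, k1.1, k1.2, k2.1, k2.2, k3.1, k3.2]
  have b2 : |T ν τ τ| ≤ 2 * B := by
    rw [abs_le]; constructor <;> linarith [k0.1, k0.2, k1.1, k1.2, k2.1, k2.2, k3.1, k3.2]
  have b3 : |T τ τ τ| ≤ 2 * B := by
    rw [abs_le]; constructor <;> linarith [k0.1, k0.2, k1.1, k1.2, k2.1, k2.2, k3.1, k3.2]
  have hB0 : 0 ≤ B := by linarith [k0.1, k0.2]
  have hdec : ∀ a : Plane, ∃ α β : ℝ, a = α • ν + β • τ ∧ |α| ≤ ‖a‖ ∧ |β| ≤ ‖a‖ := by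
    intro a
    have hn : ‖a‖ ^ 2 = a 0 ^ 2 + a 1 ^ 2 := by
      rw [EuclideanSpace.norm_sq_eq, Fin.sum_univ_two]; simp
    refine ⟨a 0 * p + a 1 * q, -(a 0 * q) + a 1 * p, ?_, ?_, ?_⟩
    · ext i
      fin_cases i
      · simp [ν, τ]; linear_combination -(a 0) * hpq
      · simp [ν, τ]; linear_combination -(a 1) * hpq
    · refine abs_le_of_sq_le_sq ?_ (norm_nonneg a)
      rw [hn]
      nlinarith [sq_nonneg (-(a 0 * q) + a 1 * p)]
    · refine abs_le_of_sq_le_sq ?_ (norm_nonneg a)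
      rw [hn]
      nlinarith [sq_nonneg (a 0 * p + a 1 * q)]
  have hbound : ∀ a b c, |T a b c| ≤ 16 * B * ‖a‖ * ‖b‖ * ‖c‖ := by
    intro a b c
    obtain ⟨α, β, ha, hα, hβ⟩ := hdec a
    obtain ⟨α', β', hb, hα', hβ'⟩ := hdec b
    obtain ⟨α'', β'', hc, hα'', hβ''⟩ := hdec c
    have term : ∀ {x y z s : ℝ}, |x| ≤ ‖a‖ → |y| ≤ ‖b‖ → |z| ≤ ‖c‖ → |s| ≤ 2 * B →
        |x * y * z * s| ≤ ‖a‖ * ‖b‖ * ‖c‖ * (2 * B) := by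
      intro x y z s hx hy hz hs
      rw [abs_mul, abs_mul, abs_mul]
      gcongr
    have he : T a b c = α * α' * α'' * T ν ν ν + α * α' * β'' * T ν ν τ + α * β' * α'' * T ν ν τ
        + α * β' * β'' * T ν τ τ + β * α' * α'' * T ν ν τ + β * α' * β'' * T ν τ τ
        + β * β' * α'' * T ν τ τ + β * β' * β'' * T τ τ τ := by
      conv_lhs => rw [ha, hb, hc]
      simp only [map_add, map_smul, add_apply, smul_apply, smul_eq_mul]
      rw [h23 ν τ ν, h12 τ ν ν, h23 ν τ ν, h12 τ ν τ, h23 τ τ ν, h12 τ ν τ]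
      ring
    rw [he]
    have t1 := abs_le.1 (term hα hα' hα'' b0)
    have t2 := abs_le.1 (term hα hα' hβ'' b1)
    have t3 := abs_le.1 (term hα hβ' hα'' b1)
    have t4 := abs_le.1 (term hα hβ' hβ'' b2)
    have t5 := abs_le.1 (term hβ hα' hα'' b1)
    have t6 := abs_le.1 (term hβ hα' hβ'' b2)
    have t7 := abs_le.1 (term hβ hβ' hα'' b2)
    have t8 := abs_le.1 (term hβ hβ' hβ'' b3)
    rw [abs_le]
    constructor <;> linarith [t1.1, t1.2, t2.1, t2.2, t3.1, t3.2, t4.1, t4.2, t5.1, t5.2, t6.1,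
      t6.2, t7.1, t7.2, t8.1, t8.2]
  refine T.opNorm_le_bound (by positivity) fun a => ?_
  refine (T a).opNorm_le_bound (by positivity) fun b => ?_
  refine (T a b).opNorm_le_bound (by positivity) fun c => hbound a b c

theorem hasDerivAt_iteratedFDeriv_line {f : Plane → ℝ} {x v : Plane} {j : ℕ} {n : WithTop ℕ∞}
    {t : ℝ} (hf : ContDiffAt ℝ n f (x + t • v)) (hj : (j : WithTop ℕ∞) + 1 ≤ n) :
    HasDerivAt (fun t : ℝ => iteratedFDeriv ℝ j f (x + t • v) fun _ => v)
      (iteratedFDeriv ℝ (j + 1) f (x + t • v) fun _ => v) t := by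
  have hd : DifferentiableAt ℝ (iteratedFDeriv ℝ j f) (x + t • v) :=
    (hf.iteratedFDeriv_right (m := 1) (by rwa [add_comm])).differentiableAt (by norm_num)
  have h2 := (ContinuousMultilinearMap.apply ℝ (fun _ : Fin j => Plane) ℝ
    (fun _ => v)).hasFDerivAt.comp_hasDerivAt t (hasDerivAt_line hd)
  -- Evaluated on a constant vector, the currying in `iteratedFDeriv` unfolds definitionally.
  exact h2

/-- The derivatives along the line `x + t v` of the square of the directional derivative `∂_v u`,
expressed through the metric. -/
noncomputable def lineJet (g : Plane → Matrix (Fin 2) (Fin 2) ℝ) (x v : Plane) (j : ℕ) (t : ℝ) : ℝ :=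
  v 0 ^ 2 * iteratedFDeriv ℝ j (fun p => g p 0 0) (x + t • v) (fun _ => v)
    + 2 * v 0 * v 1 * iteratedFDeriv ℝ j (fun p => g p 0 1) (x + t • v) (fun _ => v)
    + v 1 ^ 2 * iteratedFDeriv ℝ j (fun p => g p 1 1) (x + t • v) (fun _ => v)
    - if j = 0 then v 0 ^ 2 + v 1 ^ 2 else 0

/-- The constant is `2 · 9 · 3⁴`: `9` bounds `|v|²` and `3⁴` bounds `‖v‖ ^ j`. -/
theorem abs_lineJet_le {g : Plane → Matrix (Fin 2) (Fin 2) ℝ} {x v : Plane} {j : ℕ} {t M : ℝ}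
    (hj : j ∈ Icc 1 4) (hv : ‖v‖ ≤ 3)
    (hM : ∀ i k, ‖iteratedFDeriv ℝ j (fun p => g p i k) (x + t • v)‖ ≤ M) :
    |lineJet g x v j t| ≤ 1458 * M := by
  have hM0 : 0 ≤ M := (norm_nonneg _).trans (hM 0 0)
  have hD : ∀ i k, |iteratedFDeriv ℝ j (fun p => g p i k) (x + t • v) (fun _ => v)| ≤ 81 * M := by
    intro i k
    calc _ ≤ ‖iteratedFDeriv ℝ j (fun p => g p i k) (x + t • v)‖ * ∏ _i : Fin j, ‖v‖ :=
          ContinuousMultilinearMap.le_opNorm _ _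
      _ ≤ M * 81 := by
        rw [Finset.prod_const, Finset.card_univ, Fintype.card_fin]
        gcongr
        · exact hM i k
        · calc ‖v‖ ^ j ≤ 3 ^ j := by gcongr
            _ ≤ 3 ^ 4 := pow_le_pow_right₀ (by norm_num) hj.2
            _ = 81 := by norm_num
      _ = _ := by ring
  have hn : v 0 ^ 2 + v 1 ^ 2 ≤ 9 := by
    have : ‖v‖ ^ 2 = v 0 ^ 2 + v 1 ^ 2 := by
      rw [EuclideanSpace.norm_sq_eq, Fin.sum_univ_two]; simp
    rw [← this]; nlinarith [norm_nonneg v]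
  rw [lineJet, if_neg (by have := hj.1; omega), sub_zero]
  have e0 := hD 0 0
  have e1 := hD 0 1
  have e2 := hD 1 1
  generalize iteratedFDeriv ℝ j (fun p => g p 0 0) (x + t • v) (fun _ => v) = a at *
  generalize iteratedFDeriv ℝ j (fun p => g p 0 1) (x + t • v) (fun _ => v) = b at *
  generalize iteratedFDeriv ℝ j (fun p => g p 1 1) (x + t • v) (fun _ => v) = c at *
  have f0 : |v 0 ^ 2 * a| ≤ v 0 ^ 2 * (81 * M) := by
    rw [abs_mul, abs_of_nonneg (sq_nonneg (v 0))]; gcongr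
  have f1 : |2 * v 0 * v 1 * b| ≤ (v 0 ^ 2 + v 1 ^ 2) * (81 * M) := by
    rw [abs_mul]
    gcongr
    rw [abs_le]; constructor <;> nlinarith [sq_nonneg (v 0 - v 1), sq_nonneg (v 0 + v 1)]
  have f2 : |v 1 ^ 2 * c| ≤ v 1 ^ 2 * (81 * M) := by
    rw [abs_mul, abs_of_nonneg (sq_nonneg (v 1))]; gcongr
  calc _ ≤ |v 0 ^ 2 * a| + |2 * v 0 * v 1 * b| + |v 1 ^ 2 * c| := abs_add_three _ _ _
    _ ≤ 2 * (v 0 ^ 2 + v 1 ^ 2) * (81 * M) := by linarith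
    _ ≤ 2 * 9 * (81 * M) := by gcongr
    _ = _ := by ring

namespace IsPosGraph

variable {r : ℝ} {g : Plane → Matrix (Fin 2) (Fin 2) ℝ} {u : Plane → ℝ} {x v : Plane}

theorem lineJet_zero (h : IsPosGraph r g u) {t : ℝ} (hx : x + t • v ∈ Metric.ball 0 r) :
    lineJet g x v 0 t = fderiv ℝ u (x + t • v) v ^ 2 := by
  rw [← h.metric_quadratic hx]
  simp [lineJet]

theorem hasDerivAt_lineJet (h : IsPosGraph r g u) {t : ℝ} {j : ℕ} (hj : j < 4)
    (hx : x + t • v ∈ Metric.ball 0 r) :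
    HasDerivAt (lineJet g x v j) (lineJet g x v (j + 1) t) t := by
  have hj' : (j : WithTop ℕ∞) + 1 ≤ 4 := by exact_mod_cast hj
  have hd := fun i k => hasDerivAt_iteratedFDeriv_line (h.metric_contDiffAt hx i k) hj'
  refine (((((hd 0 0).const_mul (v 0 ^ 2)).fun_add ((hd 0 1).const_mul (2 * v 0 * v 1))).fun_add
    ((hd 1 1).const_mul (v 1 ^ 2))).sub_const _).congr_deriv ?_
  simp [lineJet]

/-- For `F = f²` with `f = ∂_v u` one has `F' = 2 f f'` and `F'' = 2 f'² + 2 f f''`, so the terms in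
`f'` cancel. -/
theorem third_deriv_eq (h : IsPosGraph r g u) (hx : x ∈ Metric.ball 0 r) (hne : fderiv ℝ u x ≠ 0) :
    4 * fderiv ℝ u x v ^ 3 * fderiv ℝ (fderiv ℝ (fderiv ℝ u)) x v v v
      = 2 * lineJet g x v 0 0 * lineJet g x v 2 0 - lineJet g x v 1 0 ^ 2 := by
  have hl : Continuous fun t : ℝ => x + t • v := by fun_prop
  have ht : Filter.Tendsto (fun t : ℝ => x + t • v) (𝓝 0) (𝓝 x) := by simpa using hl.tendsto 0
  have hC : ContDiffAt ℝ 4 u x := (h.contDiffAt_of_ne hx hne).of_le (by norm_num)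
  have hx0 : x + (0 : ℝ) • v = x := by simp
  have hg1 : ∀ᶠ t in 𝓝 (0 : ℝ), HasDerivAt (fun t : ℝ => fderiv ℝ u (x + t • v) v)
      (fderiv ℝ (fderiv ℝ u) (x + t • v) v v) t := by
    filter_upwards [ht.eventually (hC.eventually (by simp))] with t hCt
    exact hasDerivAt_line_apply
      ((hCt.fderiv_right (m := 1) (by norm_num)).differentiableAt (by norm_num))
  have hg2 : HasDerivAt (fun t : ℝ => fderiv ℝ (fderiv ℝ u) (x + t • v) v v)
      (fderiv ℝ (fderiv ℝ (fderiv ℝ u)) x v v v) 0 := by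
    have hd : DifferentiableAt ℝ (fderiv ℝ (fderiv ℝ u)) (x + (0 : ℝ) • v) := by
      rw [hx0]
      exact ((hC.fderiv_right (m := 3) (by norm_num)).fderiv_right (m := 2)
        (by norm_num)).differentiableAt (by norm_num)
    simpa using hasDerivAt_line_apply_apply (w := v) (w' := v) hd
  have hball : ∀ᶠ t in 𝓝 (0 : ℝ), x + t • v ∈ Metric.ball 0 r :=
    ht.eventually (Metric.isOpen_ball.mem_nhds hx)
  have hF0 : lineJet g x v 0 =ᶠ[𝓝 0] fun t => fderiv ℝ u (x + t • v) v ^ 2 := by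
    filter_upwards [hball] with t ht using h.lineJet_zero ht
  have hF1 : lineJet g x v 1 =ᶠ[𝓝 0]
      fun t => 2 * fderiv ℝ u (x + t • v) v * fderiv ℝ (fderiv ℝ u) (x + t • v) v v := by
    filter_upwards [hball, hF0.eventuallyEq_nhds, hg1] with t h1 h2 h3
    have e1 := h.hasDerivAt_lineJet (by norm_num : 0 < 4) h1
    refine e1.unique (((h3.fun_pow 2).congr_of_eventuallyEq h2).congr_deriv ?_)
    simp
  have hF2 : lineJet g x v 2 0 = 2 * fderiv ℝ (fderiv ℝ u) x v v ^ 2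
      + 2 * fderiv ℝ u x v * fderiv ℝ (fderiv ℝ (fderiv ℝ u)) x v v v := by
    have e1 := h.hasDerivAt_lineJet (t := 0) (v := v) (by norm_num : 1 < 4) (by simpa using hx)
    refine e1.unique ((((hg1.self_of_nhds.const_mul 2).fun_mul
      hg2).congr_of_eventuallyEq hF1).congr_deriv ?_)
    rw [hx0]; ring
  rw [hF2, hF0.self_of_nhds, hF1.self_of_nhds]
  simp only [hx0]
  ring

end IsPosGraph

/-! ### Bounds on the third derivative and regularity of the height function -/

namespace IsPosGraph

variable {r : ℝ} {g : Plane → Matrix (Fin 2) (Fin 2) ℝ} {u : Plane → ℝ} {x v : Plane}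

/-- The test directions are `ν + k τ`, with `ν` the unit gradient and `τ` orthogonal to it. The
derivative of `u` along each of them equals the length of the gradient, and `|k| ≤ 2` keeps their
norm below `3`. -/
theorem norm_third_le (h : IsPosGraph r g u) (hx : x ∈ Metric.ball 0 r) (hne : fderiv ℝ u x ≠ 0)
    {B : ℝ} (hB : ∀ v : Plane, ‖v‖ ≤ 3 → ‖fderiv ℝ u x‖ ≤ fderiv ℝ u x v →
      |fderiv ℝ (fderiv ℝ (fderiv ℝ u)) x v v v| ≤ B) :
    ‖fderiv ℝ (fderiv ℝ (fderiv ℝ u)) x‖ ≤ 16 * B := by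
  have hC : ContDiffAt ℝ 4 u x := (h.contDiffAt_of_ne hx hne).of_le (by norm_num)
  set P := fun i => pderiv i u x with hP
  set s := √(P 0 ^ 2 + P 1 ^ 2) with hs
  have hs2 : s ^ 2 = P 0 ^ 2 + P 1 ^ 2 := Real.sq_sqrt (by positivity)
  have hle : ‖fderiv ℝ u x‖ ≤ s := by
    refine ContinuousLinearMap.opNorm_le_bound _ (Real.sqrt_nonneg _) fun w => ?_
    refine abs_le_of_sq_le_sq ?_ (by positivity)
    rw [mul_pow, hs2, EuclideanSpace.norm_sq_eq, Fin.sum_univ_two, fderiv_apply_eq]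
    simp only [Real.norm_eq_abs, sq_abs, hP]
    nlinarith [sq_nonneg (w 0 * pderiv 1 u x - w 1 * pderiv 0 u x)]
  have hspos : 0 < s := (norm_pos_iff.2 hne).trans_le hle
  have hpq : (P 0 / s) ^ 2 + (P 1 / s) ^ 2 = 1 := by
    rw [div_pow, div_pow, ← add_div, ← hs2, div_self (by positivity)]
  refine norm_trilinear_le hpq (fun a b c => ?_) (fun a b c => ?_) fun k hk => hB _ ?_ ?_
  · exact congrArg (fun A => A c) (((hC.fderiv_right (m := 3)
      (by norm_num)).isSymmSndFDerivAt (by norm_num)).eq a b)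
  · have hd : DifferentiableAt ℝ (fderiv ℝ (fderiv ℝ u)) (x + (0 : ℝ) • a) := by
      rw [show x + (0 : ℝ) • a = x by simp]
      exact ((hC.fderiv_right (m := 3) (by norm_num)).fderiv_right (m := 2)
        (by norm_num)).differentiableAt (by norm_num)
    have h1 := hasDerivAt_line_apply_apply (w := b) (w' := c) hd
    have h2 := hasDerivAt_line_apply_apply (w := c) (w' := b) hd
    have he : (fun t : ℝ => fderiv ℝ (fderiv ℝ u) (x + t • a) b c) =ᶠ[𝓝 0]
        fun t : ℝ => fderiv ℝ (fderiv ℝ u) (x + t • a) c b := by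
      have hl : Continuous fun t : ℝ => x + t • a := by fun_prop
      have ht : Filter.Tendsto (fun t : ℝ => x + t • a) (𝓝 0) (𝓝 x) := by
        simpa using hl.tendsto 0
      filter_upwards [ht.eventually (hC.eventually (by simp))] with t hCt
      exact (hCt.isSymmSndFDerivAt (by norm_num)).eq b c
    simpa using h1.unique (h2.congr_of_eventuallyEq he)
  · refine (norm_add_le _ _).trans ?_
    have n1 : ∀ a b : ℝ, a ^ 2 + b ^ 2 = 1 → ‖(!₂[a, b] : Plane)‖ = 1 := fun a b hab => by
      rw [EuclideanSpace.norm_eq, Fin.sum_univ_two]; simp [hab]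
    rw [norm_smul, n1 _ _ hpq, n1 _ _ (by rw [neg_sq]; linarith), Real.norm_eq_abs]
    linarith
  · refine hle.trans (le_of_eq ?_)
    rw [fderiv_apply_eq]
    change s = (P 0 / s + k * -(P 1 / s)) * P 0 + (P 1 / s + k * (P 0 / s)) * P 1
    field_simp
    rw [hs2]; ring

theorem exists_metric_bound (h : IsPosGraph r g u) {ρ : ℝ} (hρ : ρ < r) :
    ∃ M, ∀ x ∈ Metric.closedBall (0 : Plane) ρ, ∀ i k, ∀ j ≤ 4,
      ‖iteratedFDeriv ℝ j (fun p => g p i k) x‖ ≤ M := by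
  have hc : ContinuousOn (fun x => ∑ i, ∑ k, ∑ j ∈ Finset.range 5,
      ‖iteratedFDeriv ℝ j (fun p => g p i k) x‖) (Metric.closedBall (0 : Plane) ρ) := by
    refine continuousOn_finsetSum _ fun i _ => continuousOn_finsetSum _ fun k _ =>
      continuousOn_finsetSum _ fun j hj => ContinuousOn.norm fun x hx => ?_
    have hj' : (j : WithTop ℕ∞) ≤ 4 := by
      have := Finset.mem_range.1 hj
      exact_mod_cast (by omega : j ≤ 4)
    exact ((h.metric_contDiffAt (Metric.closedBall_subset_ball hρ hx) i k).iteratedFDeriv_right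
      (m := 0) (by simpa using hj')).continuousAt.continuousWithinAt
  obtain ⟨M, hM⟩ := (isCompact_closedBall (0 : Plane) ρ).exists_bound_of_continuousOn hc
  refine ⟨M, fun x hx i k j hj => le_trans ?_ ((le_abs_self _).trans (hM x hx))⟩
  calc _ ≤ ∑ j ∈ Finset.range 5, ‖iteratedFDeriv ℝ j (fun p => g p i k) x‖ :=
        Finset.single_le_sum (f := fun j => ‖iteratedFDeriv ℝ j (fun p => g p i k) x‖)
          (fun _ _ => norm_nonneg _) (Finset.mem_range.2 (by omega))
    _ ≤ ∑ k, ∑ j ∈ Finset.range 5, ‖iteratedFDeriv ℝ j (fun p => g p i k) x‖ :=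
        Finset.single_le_sum (f := fun k => ∑ j ∈ Finset.range 5,
          ‖iteratedFDeriv ℝ j (fun p => g p i k) x‖)
          (fun _ _ => Finset.sum_nonneg fun _ _ => norm_nonneg _) (Finset.mem_univ k)
    _ ≤ _ :=
        Finset.single_le_sum (f := fun i => ∑ k, ∑ j ∈ Finset.range 5,
          ‖iteratedFDeriv ℝ j (fun p => g p i k) x‖)
          (fun _ _ => Finset.sum_nonneg fun _ _ => Finset.sum_nonneg fun _ _ => norm_nonneg _)
          (Finset.mem_univ i)

theorem exists_third_bound (h : IsPosGraph r g u) (hm : HasMonotoneGradient r u) {ρ : ℝ}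
    (hρ : ρ < r) : ∃ C, ∀ x ∈ Metric.ball (0 : Plane) ρ, x ≠ 0 →
      ‖fderiv ℝ (fderiv ℝ (fderiv ℝ u)) x‖ ≤ C := by
  obtain ⟨M, hM⟩ := h.exists_metric_bound (show (ρ + r) / 2 < r by linarith)
  -- With `‖v‖ ≤ 3` a parameter `|t| ≤ d` moves `x` by at most `(r - ρ) / 2`, so the line stays in
  -- the closed disc where `M` is valid.
  set d := (r - ρ) / 6 with hd
  have hd0 : 0 < d := by rw [hd]; linarith
  obtain ⟨C, hC⟩ := IsBoundedChain.exists_bound (1458 * |M|) d (by positivity) hd0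
  refine ⟨16 * (C / 4), fun x hx hx0 => ?_⟩
  have hxr : x ∈ Metric.ball (0 : Plane) r := Metric.ball_subset_ball hρ.le hx
  have hne := h.fderiv_ne_zero hm hxr hx0
  refine h.norm_third_le hxr hne fun v hv hPv => ?_
  have hclosed : ∀ t ∈ Icc (-d) d, x + t • v ∈ Metric.closedBall (0 : Plane) ((ρ + r) / 2) := by
    intro t ht
    rw [mem_closedBall_zero_iff]
    have hxρ := mem_ball_zero_iff.1 hx
    have : ‖t • v‖ ≤ d * 3 := by
      rw [norm_smul]
      have : ‖t‖ ≤ d := abs_le.2 ht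
      gcongr
    calc ‖x + t • v‖ ≤ ‖x‖ + ‖t • v‖ := norm_add_le _ _
      _ ≤ ρ + d * 3 := by linarith
      _ = _ := by rw [hd]; ring
  have hball : ∀ t ∈ Icc (-d) d, x + t • v ∈ Metric.ball (0 : Plane) r := fun t ht =>
    Metric.closedBall_subset_ball (by linarith) (hclosed t ht)
  have hpos : 0 < fderiv ℝ u x v := (norm_pos_iff.2 hne).trans_le hPv
  have key := hC (lineJet g x v) (fun t => fderiv ℝ u (x + t • v) v)
    ⟨fun j hj t ht => h.hasDerivAt_lineJet hj (hball t ht), fun j hj t ht =>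
      abs_lineJet_le hj hv fun i k => (hM _ (hclosed t ht) i k j hj.2).trans (le_abs_self M)⟩
    (fun t ht => h.lineJet_zero (hball t ht))
    (fun t ht => (ContinuousAt.comp (f := fun t : ℝ => x + t • v) (g := fun y => fderiv ℝ u y v)
      ((h.continuousAt_fderiv (hball t ht)).clm_apply continuousAt_const)
      (by fun_prop)).continuousWithinAt)
    (fun s hs t ht hst => ?_) (by simpa using hpos.ne')
  · rw [← h.third_deriv_eq hxr hne] at key
    simp only [zero_smul, add_zero] at key
    rw [abs_mul, abs_mul, abs_pow, abs_of_pos hpos, abs_of_pos (by norm_num : (0 : ℝ) < 4)] at key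
    have h3 : 0 < fderiv ℝ u x v ^ 3 := by positivity
    refine le_of_mul_le_mul_right (a := 4 * fderiv ℝ u x v ^ 3) ?_ (by positivity)
    linarith
  · rcases hst.eq_or_lt with rfl | hlt
    · exact le_rfl
    · have := hm _ (hball s hs) _ (hball t ht)
      rw [show x + t • v - (x + s • v) = (t - s) • v by rw [sub_smul]; abel, map_smul, map_smul,
        smul_eq_mul, smul_eq_mul] at this
      exact le_of_mul_le_mul_left this (by linarith)

/-- On `‖x‖ < r / 2` the interior bound applies. Beyond it there may be no room for a line of fixed
length, but the derivative of `u` along `v` is at least `c > 0`, so `third_deriv_eq` at the point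
itself suffices. -/
theorem exists_third_bound_of_bounded (h : IsPosGraph r g u) (hm : HasMonotoneGradient r u)
    (hb : HasBoundedDerivsOn 4 g (Metric.ball 0 r)) :
    ∃ C, ∀ x ∈ Metric.ball (0 : Plane) r, x ≠ 0 →
      ‖fderiv ℝ (fderiv ℝ (fderiv ℝ u)) x‖ ≤ C := by
  have hr := h.pos
  obtain ⟨C, hC⟩ := h.exists_third_bound hm (show r / 2 < r by linarith)
  obtain ⟨c, hc0, hc⟩ := h.exists_lower_bound hm (half_pos hr) (by linarith)
  obtain ⟨M₀, hM₀⟩ := hb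
  set M := 1458 * |M₀|
  refine ⟨max C (16 * ((2 * M / c + M ^ 2 / c ^ 3) / 4)), fun x hx hx0 => ?_⟩
  rcases lt_or_ge ‖x‖ (r / 2) with hlt | hge
  · exact (hC x (mem_ball_zero_iff.2 hlt) hx0).trans (le_max_left _ _)
  refine le_trans ?_ (le_max_right _ _)
  have hne := h.fderiv_ne_zero hm hx hx0
  refine h.norm_third_le hx hne fun v hv hPv => ?_
  have hca : c ≤ fderiv ℝ u x v := (hc x hx hge).trans hPv
  have hJ : ∀ j ∈ Icc 1 4, |lineJet g x v j 0| ≤ M := fun j hj =>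
    abs_lineJet_le hj hv fun i k => (hM₀ i k j hj.2 _ (by simpa using hx)).trans (le_abs_self M₀)
  have key := h.third_deriv_eq (v := v) hx hne
  rw [h.lineJet_zero (by simpa using hx), zero_smul, add_zero] at key
  have hM0 : 0 ≤ M := by positivity
  generalize fderiv ℝ u x v = a at *
  have ha : 0 < a := hc0.trans_le hca
  have hca1 : 1 ≤ a / c := by rwa [one_le_div hc0]
  have e1 : |2 * a ^ 2 * lineJet g x v 2 0| ≤ 2 * M / c * a ^ 3 := by
    rw [abs_mul, abs_of_pos (by positivity)]
    calc 2 * a ^ 2 * |lineJet g x v 2 0| ≤ 2 * a ^ 2 * M * 1 := by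
          rw [mul_one]; gcongr; exact hJ 2 (by simp)
      _ ≤ 2 * a ^ 2 * M * (a / c) := by gcongr
      _ = _ := by field_simp
  have e2 : |lineJet g x v 1 0 ^ 2| ≤ M ^ 2 / c ^ 3 * a ^ 3 := by
    rw [abs_pow]
    calc |lineJet g x v 1 0| ^ 2 ≤ M ^ 2 * 1 := by rw [mul_one]; gcongr; exact hJ 1 (by simp)
      _ ≤ M ^ 2 * (a / c) ^ 3 := by gcongr; exact one_le_pow₀ hca1
      _ = _ := by field_simp
  have e3 := (abs_sub _ _).trans (add_le_add e1 e2)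
  rw [← key, abs_mul, abs_of_pos (by positivity)] at e3
  refine le_of_mul_le_mul_right (a := 4 * a ^ 3) ?_ (by positivity)
  linarith

theorem regular_of_third_bound (h : IsPosGraph r g u) (hm : HasMonotoneGradient r u) {ρ C : ℝ}
    (hρ : 0 < ρ) (hρr : ρ ≤ r) (hC : ∀ x ∈ Metric.ball (0 : Plane) ρ, x ≠ 0 →
      ‖fderiv ℝ (fderiv ℝ (fderiv ℝ u)) x‖ ≤ C) :
    ContDiffOn ℝ 2 u (Metric.ball 0 ρ) ∧
      ∃ K, LipschitzOnWith K (fderiv ℝ (fderiv ℝ u)) (Metric.ball 0 ρ) := by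
  have hsub : Metric.ball (0 : Plane) ρ ⊆ Metric.ball 0 r := Metric.ball_subset_ball hρr
  have hreg : ∀ x ∈ Metric.ball (0 : Plane) ρ, x ≠ 0 → ContDiffAt ℝ 4 (fderiv ℝ u) x :=
    fun x hx hx0 => (h.contDiffAt_of_ne (hsub hx)
      (h.fderiv_ne_zero hm (hsub hx) hx0)).fderiv_right (by norm_num)
  have hL : LipschitzOnWith C.toNNReal (fderiv ℝ (fderiv ℝ u)) (Metric.ball 0 ρ \ {0}) :=
    lipschitzOnWith_punctured_ball (fun x hx hx0 =>
      ((hreg x hx hx0).fderiv_right (m := 3) (by norm_num)).differentiableAt (by norm_num))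
      fun x hx hx0 => (hC x hx hx0).trans (Real.le_coe_toNNReal C)
  obtain ⟨hd, K, hK⟩ := differentiable_of_punctured hρ (h.continuousOn_fderiv.mono hsub)
    (fun x hx hx0 => (hreg x hx hx0).differentiableAt (by norm_num)) hL
  refine ⟨?_, K, hK⟩
  rw [show (2 : WithTop ℕ∞) = 1 + 1 by norm_num,
    contDiffOn_succ_iff_fderiv_of_isOpen Metric.isOpen_ball]
  refine ⟨fun x hx => (h.differentiableAt (hsub hx)).differentiableWithinAt, by simp, ?_⟩
  rw [show (1 : WithTop ℕ∞) = 0 + 1 by norm_num,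
    contDiffOn_succ_iff_fderiv_of_isOpen Metric.isOpen_ball]
  exact ⟨fun x hx => (hd x hx).differentiableWithinAt, by simp,
    contDiffOn_zero.2 hK.continuousOn⟩

theorem regular_of_monotone (h : IsPosGraph r g u) (hm : HasMonotoneGradient r u) :
    (∀ ρ, 0 < ρ → ρ < r → ContDiffOn ℝ 2 u (Metric.ball 0 ρ) ∧
      ∃ K, LipschitzOnWith K (fderiv ℝ (fderiv ℝ u)) (Metric.ball 0 ρ)) ∧
    (HasBoundedDerivsOn 4 g (Metric.ball 0 r) →
      ∃ K, LipschitzOnWith K (fderiv ℝ (fderiv ℝ u)) (Metric.ball 0 r)) := by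
  refine ⟨fun ρ hρ hρr => ?_, fun hb => ?_⟩
  · obtain ⟨C, hC⟩ := h.exists_third_bound hm hρr
    exact h.regular_of_third_bound hm hρ hρr.le hC
  · obtain ⟨C, hC⟩ := h.exists_third_bound_of_bounded hm hb
    exact (h.regular_of_third_bound hm h.pos le_rfl hC).2

theorem regular (h : IsPosGraph r g u) :
    (∀ ρ, 0 < ρ → ρ < r → ContDiffOn ℝ 2 u (Metric.ball 0 ρ) ∧
      ∃ K, LipschitzOnWith K (fderiv ℝ (fderiv ℝ u)) (Metric.ball 0 ρ)) ∧
    (HasBoundedDerivsOn 4 g (Metric.ball 0 r) →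
      ∃ K, LipschitzOnWith K (fderiv ℝ (fderiv ℝ u)) (Metric.ball 0 r)) := by
  rcases h.hasMonotoneGradient_or with hm | hm
  · exact h.regular_of_monotone hm
  · have hneg : fderiv ℝ (fderiv ℝ (-u)) = -fderiv ℝ (fderiv ℝ u) := by
      have : fderiv ℝ (-u) = -fderiv ℝ u := by ext1 x; exact fderiv_neg
      rw [this]
      ext1 x; exact fderiv_neg
    have hL : ∀ ρ, (∃ K, LipschitzOnWith K (fderiv ℝ (fderiv ℝ (-u))) (Metric.ball 0 ρ)) →
        ∃ K, LipschitzOnWith K (fderiv ℝ (fderiv ℝ u)) (Metric.ball 0 ρ) := by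
      rintro ρ ⟨K, hK⟩
      refine ⟨K, fun x hx y hy => ?_⟩
      have := hK hx hy
      rwa [hneg, Pi.neg_apply, Pi.neg_apply, edist_neg_neg] at this
    obtain ⟨h1, h2⟩ := h.neg.regular_of_monotone hm
    exact ⟨fun ρ hρ hρr => ⟨by simpa using (h1 ρ hρ hρr).1.neg, hL ρ (h1 ρ hρ hρr).2⟩,
      fun hb => hL r (h2 hb)⟩

end IsPosGraph

/-! ### From the height function to the graph map -/

/-- The embedding of the plane as the horizontal plane. -/
noncomputable def horizontal : Plane →L[ℝ] Space :=
  (EuclideanSpace.proj 0 : Plane →L[ℝ] ℝ).smulRight (EuclideanSpace.single 0 1)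
    + (EuclideanSpace.proj 1 : Plane →L[ℝ] ℝ).smulRight (EuclideanSpace.single 1 1)

theorem graphMap_eq (u : Plane → ℝ) :
    graphMap u = fun p => horizontal p + u p • EuclideanSpace.single 2 (1 : ℝ) := by
  ext p i
  fin_cases i <;> simp [graphMap, horizontal]

theorem apply_graphMap (u : Plane → ℝ) : u = fun p => graphMap u p 2 := by
  ext p; simp [graphMap]

section

variable {u : Plane → ℝ} {U : Set Plane} {p : Plane}

theorem contDiffOn_graphMap_iff {n : WithTop ℕ∞} :
    ContDiffOn ℝ n (graphMap u) U ↔ ContDiffOn ℝ n u U := by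
  constructor
  · intro h
    rw [apply_graphMap u]
    exact (EuclideanSpace.proj (2 : Fin 3) : Space →L[ℝ] ℝ).contDiff.comp_contDiffOn h
  · intro h
    rw [graphMap_eq]
    exact horizontal.contDiff.contDiffOn.add (h.smul contDiffOn_const)

/-- `ℓ ↦ (v ↦ ℓ v • e₃)`. -/
noncomputable def verticalLift : (Plane →L[ℝ] ℝ) →L[ℝ] Plane →L[ℝ] Space :=
  (ContinuousLinearMap.smulRightL ℝ Plane Space).flip (EuclideanSpace.single 2 1)

theorem fderiv_graphMap (hu : DifferentiableAt ℝ u p) :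
    fderiv ℝ (graphMap u) p = horizontal + verticalLift (fderiv ℝ u p) := by
  rw [graphMap_eq]
  exact (horizontal.hasFDerivAt.add (hu.hasFDerivAt.smul_const _)).fderiv

theorem fderiv_fderiv_graphMap (hU : IsOpen U) (hu : ContDiffOn ℝ 2 u U) (hp : p ∈ U) :
    fderiv ℝ (fderiv ℝ (graphMap u)) p = verticalLift ∘L fderiv ℝ (fderiv ℝ u) p := by
  have he : fderiv ℝ (graphMap u) =ᶠ[𝓝 p] fun q => horizontal + verticalLift (fderiv ℝ u q) := by
    filter_upwards [hU.mem_nhds hp] with q hq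
    exact fderiv_graphMap ((hu.contDiffAt (hU.mem_nhds hq)).differentiableAt (by norm_num))
  have hd : DifferentiableAt ℝ (fderiv ℝ u) p :=
    ((hu.contDiffAt (hU.mem_nhds hp)).fderiv_right (m := 1) (by norm_num)).differentiableAt
      (by norm_num)
  rw [he.fderiv_eq]
  exact ((verticalLift.hasFDerivAt.comp p hd.hasFDerivAt).const_add horizontal).fderiv

theorem lipschitzOnWith_iteratedFDeriv_two_graphMap (hU : IsOpen U) (hu : ContDiffOn ℝ 2 u U)
    {K : NNReal} (hK : LipschitzOnWith K (fderiv ℝ (fderiv ℝ u)) U) :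
    LipschitzOnWith (‖verticalLift‖₊ * K) (iteratedFDeriv ℝ 2 (graphMap u)) U := by
  refine LipschitzOnWith.of_dist_le_mul fun x hx y hy => ?_
  rw [dist_iteratedFDeriv_two, fderiv_fderiv_graphMap hU hu hx, fderiv_fderiv_graphMap hU hu hy,
    dist_eq_norm, ← ContinuousLinearMap.comp_sub]
  refine (ContinuousLinearMap.opNorm_comp_le _ _).trans ?_
  rw [← dist_eq_norm, NNReal.coe_mul, coe_nnnorm, mul_assoc]
  gcongr
  exact hK.dist_le_mul x hx y hy

theorem firstFundamentalForm_graphMap (hu : DifferentiableAt ℝ u p) (i j : Fin 2) :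
    firstFundamentalForm (graphMap u) p i j = graphMetric u i j p := by
  simp only [firstFundamentalForm, Matrix.of_apply, pderiv, fderiv_graphMap hu, graphMetric]
  rw [PiLp.inner_apply, Fin.sum_univ_three]
  fin_cases i <;> fin_cases j <;> simp [horizontal, verticalLift] <;> ring

end

theorem isPosGraph_of_isometric {r : ℝ} {g : Plane → Matrix (Fin 2) (Fin 2) ℝ} {u : Plane → ℝ}
    (hr : 0 < r) (hg : IsMetricOn 4 g (Metric.ball 0 r))
    (hK : ∀ p ∈ Metric.ball (0 : Plane) r, p ≠ 0 → 0 < gaussCurvature g p)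
    (hX : IsIsometricEmbeddingOn g (graphMap u) (Metric.ball 0 r))
    (hu : ∀ i, pderiv i u 0 = 0) : IsPosGraph r g u := by
  have hC : ContDiffOn ℝ 1 u (Metric.ball 0 r) := contDiffOn_graphMap_iff.1 hX.1
  refine ⟨hr, hC, hg.1, fun x hx i j => ?_, hK, by rw [fderiv_eq_pderiv, hu, hu]; simp⟩
  rw [← hX.2.1 x hx, firstFundamentalForm_graphMap]
  exact (hC.contDiffAt (Metric.isOpen_ball.mem_nhds hx)).differentiableAt (by norm_num)

theorem IsPosGraph.graphMap_regular {r : ℝ} {g : Plane → Matrix (Fin 2) (Fin 2) ℝ} {u : Plane → ℝ}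
    (h : IsPosGraph r g u) : IsCkLipOn 2 (graphMap u) (Metric.ball 0 r) ∧
      (HasBoundedDerivsOn 4 g (Metric.ball 0 r) →
        ∃ K, LipschitzOnWith K (iteratedFDeriv ℝ 2 (graphMap u)) (Metric.ball 0 r)) := by
  obtain ⟨h1, h2⟩ := h.regular
  have hex : ∀ x ∈ Metric.ball (0 : Plane) r, ∃ ρ, 0 < ρ ∧ ρ < r ∧ x ∈ Metric.ball (0 : Plane) ρ :=
    fun x hx => by
      rw [mem_ball_zero_iff] at hx
      refine ⟨(‖x‖ + r) / 2, by linarith [norm_nonneg x, h.pos], by linarith, ?_⟩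
      rw [mem_ball_zero_iff]; linarith
  have hC : ContDiffOn ℝ 2 u (Metric.ball 0 r) := by
    intro x hx
    obtain ⟨ρ, hρ, hρr, hxρ⟩ := hex x hx
    exact ((h1 ρ hρ hρr).1.contDiffAt (Metric.isOpen_ball.mem_nhds hxρ)).contDiffWithinAt
  refine ⟨⟨contDiffOn_graphMap_iff.2 hC, fun x hx => ?_⟩, fun hb => ?_⟩
  · obtain ⟨ρ, hρ, hρr, hxρ⟩ := hex x hx
    obtain ⟨hCρ, K, hK⟩ := h1 ρ hρ hρr
    exact ⟨_, Metric.ball 0 ρ, mem_nhdsWithin_of_mem_nhds (Metric.isOpen_ball.mem_nhds hxρ),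
      lipschitzOnWith_iteratedFDeriv_two_graphMap Metric.isOpen_ball hCρ hK⟩
  · obtain ⟨K, hK⟩ := h2 hb
    exact ⟨_, lipschitzOnWith_iteratedFDeriv_two_graphMap Metric.isOpen_ball hC hK⟩

/-! ### Optimality: the cubic cone -/

section CubicCone

theorem cubicCone_eq : cubicCone = fun p => ‖p‖ ^ (3 : ℝ) := by
  ext p
  rw [cubicCone, EuclideanSpace.norm_eq, Fin.sum_univ_two, Real.norm_eq_abs, Real.norm_eq_abs,
    sq_abs, sq_abs, Real.sqrt_eq_rpow, ← Real.rpow_mul (by positivity)]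
  norm_num

theorem hasFDerivAt_cubicCone (p : Plane) :
    HasFDerivAt cubicCone ((3 * ‖p‖) • innerSL ℝ p) p := by
  rw [cubicCone_eq]
  have := hasFDerivAt_norm_rpow p (show (1 : ℝ) < 3 by norm_num)
  rwa [show (3 : ℝ) - 2 = 1 by norm_num, Real.rpow_one] at this

theorem fderiv_cubicCone : fderiv ℝ cubicCone = fun p => (3 * ‖p‖) • innerSL ℝ p :=
  funext fun p => (hasFDerivAt_cubicCone p).fderiv

theorem pderiv_cubicCone (i : Fin 2) : pderiv i cubicCone = fun p => 3 * ‖p‖ * p i := by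
  ext p
  simp [pderiv, fderiv_cubicCone, EuclideanSpace.inner_single_right]

theorem contDiff_one_cubicCone : ContDiff ℝ 1 cubicCone := by
  rw [cubicCone_eq]
  exact contDiff_norm_rpow (by norm_num)

theorem contDiffAt_cubicCone {n : WithTop ℕ∞} {p : Plane} (hp : p ≠ 0) :
    ContDiffAt ℝ n cubicCone p := by
  rw [cubicCone_eq]
  exact (contDiffAt_norm ℝ hp).rpow_const_of_ne (norm_ne_zero_iff.2 hp)

theorem norm_sq_plane (p : Plane) : ‖p‖ ^ 2 = p 0 ^ 2 + p 1 ^ 2 := by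
  rw [EuclideanSpace.norm_sq_eq, Fin.sum_univ_two]; simp

theorem pderiv_coord (i j : Fin 2) (p : Plane) :
    pderiv j (fun q : Plane => q i) p = if i = j then 1 else 0 := by
  have : HasFDerivAt (fun q : Plane => q i) (EuclideanSpace.proj i : Plane →L[ℝ] ℝ) p :=
    (EuclideanSpace.proj i : Plane →L[ℝ] ℝ).hasFDerivAt
  rw [pderiv, this.fderiv]
  simp

theorem differentiableAt_coord (i : Fin 2) (p : Plane) :
    DifferentiableAt ℝ (fun q : Plane => q i) p :=
  (EuclideanSpace.proj i : Plane →L[ℝ] ℝ).differentiableAt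

theorem pderiv_norm {p : Plane} (hp : p ≠ 0) (j : Fin 2) :
    pderiv j (fun q : Plane => ‖q‖) p = p j / ‖p‖ := by
  have hN : DifferentiableAt ℝ (fun q : Plane => ‖q‖) p :=
    (contDiffAt_norm (n := 1) ℝ hp).differentiableAt (by norm_num)
  have h1 := pderiv_mul j hN hN
  have he : (fun q : Plane => ‖q‖ * ‖q‖) = fun q => q 0 * q 0 + q 1 * q 1 := by
    ext q; rw [← sq, norm_sq_plane]; ring
  rw [he, pderiv_add j ((differentiableAt_coord 0 p).fun_mul (differentiableAt_coord 0 p))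
    ((differentiableAt_coord 1 p).fun_mul (differentiableAt_coord 1 p)),
    pderiv_mul j (differentiableAt_coord 0 p) (differentiableAt_coord 0 p),
    pderiv_mul j (differentiableAt_coord 1 p) (differentiableAt_coord 1 p), pderiv_coord,
    pderiv_coord] at h1
  have hn : ‖p‖ ≠ 0 := norm_ne_zero_iff.2 hp
  rw [eq_div_iff hn]
  fin_cases j <;> simp at h1 ⊢ <;> linarith

theorem pderiv_pderiv_cubicCone {p : Plane} (hp : p ≠ 0) (i j : Fin 2) :
    pderiv j (pderiv i cubicCone) p
      = 3 * (p i * p j / ‖p‖ + if i = j then ‖p‖ else 0) := by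
  have hN : DifferentiableAt ℝ (fun q : Plane => ‖q‖) p :=
    (contDiffAt_norm (n := 1) ℝ hp).differentiableAt (by norm_num)
  rw [pderiv_cubicCone, pderiv_mul j (hN.const_mul 3) (differentiableAt_coord i p),
    pderiv_mul j (differentiableAt_const 3) hN, pderiv_norm hp, pderiv_coord]
  have : pderiv j (fun _ : Plane => (3 : ℝ)) p = 0 := by simp [pderiv]
  rw [this]
  split_ifs <;> ring

theorem hessDet_cubicCone {p : Plane} (hp : p ≠ 0) : hessDet cubicCone p = 18 * ‖p‖ ^ 2 := by
  have hn : ‖p‖ ≠ 0 := norm_ne_zero_iff.2 hp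
  have h2 := norm_sq_plane p
  simp only [hessDet, pderiv_pderiv_cubicCone hp]
  simp
  field_simp
  linear_combination (-9 : ℝ) * ‖p‖ ^ 2 * h2

/-- The metric of the graph of `cubicCone`. -/
noncomputable def cubicMetric (p : Plane) : Matrix (Fin 2) (Fin 2) ℝ :=
  Matrix.of fun i j => graphMetric cubicCone i j p

theorem isMetricOn_cubicMetric (U : Set Plane) : IsMetricOn ∞ cubicMetric U := by
  refine ⟨fun i j => ?_, fun p _ => ?_⟩
  -- The gradient is `3 ‖p‖ p`; its products contain only `‖p‖ ^ 2`, so the metric is polynomial.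
  · have : (fun p => cubicMetric p i j) = fun p : Plane =>
        (if i = j then 1 else 0) + 9 * ‖p‖ ^ 2 * (p i * p j) := by
      ext p
      simp only [cubicMetric, Matrix.of_apply, graphMetric, pderiv_cubicCone]
      ring
    rw [this]
    have hc : ∀ i : Fin 2, ContDiff ℝ ∞ fun p : Plane => p i := fun i =>
      (EuclideanSpace.proj i : Plane →L[ℝ] ℝ).contDiff
    exact (contDiff_const.add ((contDiff_const.mul (contDiff_norm_sq ℝ)).mul
      ((hc i).mul (hc j)))).contDiffOn
  · have : cubicMetric p = 1 + Matrix.vecMulVec (fun i => pderiv i cubicCone p)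
        (star fun i => pderiv i cubicCone p) := by
      ext i j
      simp [cubicMetric, graphMetric, Matrix.vecMulVec_apply, Matrix.one_apply]
    rw [this]
    exact Matrix.PosDef.one.add_posSemidef (Matrix.posSemidef_vecMulVec_self_star _)

theorem gaussCurvature_cubicMetric_pos {p : Plane} (hp : p ≠ 0) :
    0 < gaussCurvature cubicMetric p := by
  have hn : 0 < ‖p‖ := norm_pos_iff.2 hp
  rw [gaussCurvature_eq (g := cubicMetric) (u := cubicCone) (contDiffAt_cubicCone hp)
    (fun i j => Filter.EventuallyEq.rfl), hessDet_cubicCone hp]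
  positivity

theorem isCkLipOn_cubicCone (r : ℝ) : IsCkLipOn 1 (graphMap cubicCone) (Metric.ball 0 r) := by
  refine ⟨contDiffOn_graphMap_iff.2 contDiff_one_cubicCone.contDiffOn, ?_⟩
  have hd : ∀ p, DifferentiableAt ℝ cubicCone p := fun p => (hasFDerivAt_cubicCone p).differentiableAt
  have hL : LipschitzOnWith (‖verticalLift‖₊ * (6 * r.toNNReal))
      (iteratedFDeriv ℝ 1 (graphMap cubicCone)) (Metric.ball 0 r) := by
    refine LipschitzOnWith.of_dist_le_mul fun x hx y hy => ?_
    rw [mem_ball_zero_iff] at hx hy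
    have hr : 0 < r := (norm_nonneg x).trans_lt hx
    rw [dist_iteratedFDeriv_one, fderiv_graphMap (hd x), fderiv_graphMap (hd y), dist_add_left,
      dist_eq_norm, ← map_sub, NNReal.coe_mul, coe_nnnorm, mul_assoc]
    refine (verticalLift.le_opNorm _).trans ?_
    gcongr
    -- The difference is split so that each of the two summands has norm at most `r * ‖x - y‖`.
    have e : fderiv ℝ cubicCone x - fderiv ℝ cubicCone y
        = innerSL ℝ ((3 : ℝ) • (‖x‖ • (x - y) + (‖x‖ - ‖y‖) • y)) := by
      simp only [fderiv_cubicCone, map_smul, map_add, map_sub]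
      module
    rw [e, innerSL_apply_norm, norm_smul, dist_eq_norm]
    have h1 : ‖‖x‖ • (x - y) + (‖x‖ - ‖y‖) • y‖ ≤ r * ‖x - y‖ + ‖x - y‖ * r := by
      refine (norm_add_le _ _).trans ?_
      rw [norm_smul, norm_smul, norm_norm]
      gcongr
      exact abs_norm_sub_norm_le x y
    push_cast
    rw [Real.coe_toNNReal r hr.le, Real.norm_of_nonneg (by norm_num)]
    linarith
  exact fun x hx => ⟨_, _, self_mem_nhdsWithin, hL⟩

/-- Projection to the first two coordinates is a continuous left inverse. -/
theorem isEmbedding_graphMap {u : Plane → ℝ} {U : Set Plane} (hu : ContinuousOn (graphMap u) U) :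
    IsEmbedding (U.domRestrict (graphMap u)) := by
  have hg : Continuous fun q : Space => (!₂[q 0, q 1] : Plane) := by fun_prop
  refine IsEmbedding.of_comp (continuousOn_iff_continuous_domRestrict.1 hu) hg ?_
  convert IsEmbedding.subtypeVal (p := (· ∈ U)) using 1
  ext p i
  fin_cases i <;> simp [graphMap, Set.domRestrict]

theorem isIsometricEmbeddingOn_cubicCone (U : Set Plane) :
    IsIsometricEmbeddingOn cubicMetric (graphMap cubicCone) U := by
  have hC : ContDiffOn ℝ 1 (graphMap cubicCone) U :=
    contDiffOn_graphMap_iff.2 contDiff_one_cubicCone.contDiffOn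
  refine ⟨hC, fun p _ => ?_, isEmbedding_graphMap hC.continuousOn⟩
  ext i j
  rw [firstFundamentalForm_graphMap (hasFDerivAt_cubicCone p).differentiableAt]
  rfl

/-- On the first axis `u_xx` equals `6 |t|`, first for `t ≠ 0` and then, by continuity, at `0`; this
is not differentiable. -/
theorem not_contDiffOn_cubicCone {r : ℝ} (hr : 0 < r) :
    ¬ ContDiffOn ℝ 3 (graphMap cubicCone) (Metric.ball 0 r) := by
  intro h
  have h0 : ContDiffAt ℝ 3 cubicCone 0 := (contDiffOn_graphMap_iff.1 h).contDiffAt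
    (Metric.isOpen_ball.mem_nhds (Metric.mem_ball_self hr))
  have hd : DifferentiableAt ℝ (pderiv 0 (pderiv 0 cubicCone)) 0 :=
    (contDiffAt_pderiv (contDiffAt_pderiv h0 (m := 2) (by norm_num) 0) (m := 1) (by norm_num)
      0).differentiableAt (by norm_num)
  set f : ℝ → ℝ := fun t =>
    pderiv 0 (pderiv 0 cubicCone) (0 + t • EuclideanSpace.single 0 (1 : ℝ)) with hf
  have hfd : DifferentiableAt ℝ f 0 :=
    (hasDerivAt_line (by simpa using hd)).differentiableAt
  have hne : ∀ t ≠ 0, f t = 6 * |t| := by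
    intro t ht
    have hp : (0 : Plane) + t • EuclideanSpace.single 0 (1 : ℝ) ≠ 0 := by simp [ht]
    rw [hf]
    simp only [pderiv_pderiv_cubicCone hp]
    simp [norm_smul]
    have ht' : |t| ≠ 0 := abs_ne_zero.2 ht
    field_simp
    nlinarith [abs_mul_abs_self t]
  have hev : f =ᶠ[𝓝[≠] 0] fun t => 6 * |t| := by
    filter_upwards [self_mem_nhdsWithin] with t ht using hne t ht
  have hc : Filter.Tendsto (fun t : ℝ => 6 * |t|) (𝓝[≠] 0) (𝓝 (6 * |0|)) :=
    (Continuous.tendsto (by fun_prop) 0).mono_left nhdsWithin_le_nhds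
  have hf0 : f 0 = 6 * |0| := tendsto_nhds_unique
    (hfd.continuousAt.tendsto.mono_left nhdsWithin_le_nhds) (hc.congr' hev.symm)
  have hfe : f = fun t => 6 * |t| := by
    ext t
    rcases eq_or_ne t 0 with rfl | ht
    · exact hf0
    · exact hne t ht
  refine not_differentiableAt_abs_zero ?_
  rw [hfe] at hfd
  simpa using hfd.const_mul (1 / 6 : ℝ)

end CubicCone

end GraphEmbedding

theorem theorem1p1 :
    (∀ (r : ℝ) (g : Plane → Matrix (Fin 2) (Fin 2) ℝ) (u : Plane → ℝ),
      0 < r →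
      IsMetricOn 4 g (Metric.ball 0 r) →
      (∀ p ∈ Metric.ball (0 : Plane) r, p ≠ 0 → 0 < gaussCurvature g p) →
      IsCkLipOn 1 (graphMap u) (Metric.ball 0 r) →
      IsIsometricEmbeddingOn g (graphMap u) (Metric.ball 0 r) →
      u 0 = 0 → (∀ i, pderiv i u 0 = 0) →
      IsCkLipOn 2 (graphMap u) (Metric.ball 0 r) ∧
        (HasBoundedDerivsOn 4 g (Metric.ball 0 r) →
          ∃ K, LipschitzOnWith K (iteratedFDeriv ℝ 2 (graphMap u)) (Metric.ball 0 r))) ∧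
    (∀ r : ℝ, 0 < r →
      ∃ g : Plane → Matrix (Fin 2) (Fin 2) ℝ,
        IsMetricOn ∞ g (Metric.ball 0 r) ∧
        (∀ p ∈ Metric.ball (0 : Plane) r, p ≠ 0 → 0 < gaussCurvature g p) ∧
        IsCkLipOn 1 (graphMap cubicCone) (Metric.ball 0 r) ∧
        IsIsometricEmbeddingOn g (graphMap cubicCone) (Metric.ball 0 r) ∧
        cubicCone 0 = 0 ∧ (∀ i, pderiv i cubicCone 0 = 0) ∧
        ¬ ContDiffOn ℝ 3 (graphMap cubicCone) (Metric.ball 0 r)) := by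
  refine ⟨fun r g u hr hg hK _ hX _ hu => (isPosGraph_of_isometric hr hg hK hX hu).graphMap_regular,
    fun r hr => ⟨cubicMetric, isMetricOn_cubicMetric _,
      fun p _ hp => gaussCurvature_cubicMetric_pos hp, isCkLipOn_cubicCone r,
      isIsometricEmbeddingOn_cubicCone _, by simp [cubicCone_eq],
      fun i => by simp [pderiv_cubicCone], not_contDiffOn_cubicCone hr⟩⟩
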